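/- **Theorem (Generalisation of MKNF models).** Let $\mathcal K$ be an updatable hybrid knowledge base and let $M$ be an MKNF interpretation. Then $M$ is a dynamic MKNF model of the one-element sequence $\langle\mathcal K\rangle$ if and only if $M$ is an MKNF model of $\mathcal K$. The notions used are the following. *MKNF.* Fix a function-free first-order signature with a set $\mathbf P$ of predicate symbols and an infinite set $\Delta$ of constants. MKNF formulae are built from atoms $P(t_1,\dots,t_n)$ with $\neg,\wedge,\exists$ and the modal operators $\mathbf K$, $\mathbf{not}$; $\mathsf{pr}(\cdot)$ denotes the set of predicate symbols occurring in an expression. An interpretation is a set of ground atoms; $\mathcal I$ is the set of all interpretations; an MKNF interpretation is a nonempty subset of $\mathcal I$. For $I\in\mathcal I$ and $M,N\subseteq\mathcal I$: $(I,M,N)\models p$ iff $p\in I$ (for a ground atom $p$); $\neg,\wedge$ are as usual; $(I,M,N)\models\exists x\,\varphi$ iff $(I,M,N)\models\varphi[c/x]$ for some $c\in\Delta$; $(I,M,N)\models\mathbf K\varphi$ iff $(J,M,N)\models\varphi$ for all $J\in M$; $(I,M,N)\models\mathbf{not}\,\varphi$ iff $(J,M,N)\not\models\varphi$ for some $J\in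 N$. For a set $T$ of sentences, $M\models T$ means $(I,M,M)\models\varphi$ for all $\varphi\in T$, $I\in M$. An MKNF interpretation $M$ is an MKNF model of $T$ if $M\models T$ and for every $M'\supsetneq M$ there are $I'\in M'$ and $\varphi\in T$ with $(I',M',M)\not\models\varphi$. For a first-order theory $T$, $\mathsf{mod}(T)$ is the greatest $M\subseteq\mathcal I$ with $M\models T$. *Hybrid knowledge bases.* A literal is a ground atom $p$ or a default literal ${\sim}p$ (with ${\sim}{\sim}p=p$). A rule $r$ has a head literal $H(r)$ and a finite set $B(r)$ of body literals; it is positive if its head is an atom and a fact if $B(r)=\emptyset$. A program is a set of rules. A hybrid knowledge base is a pair $\mathcal K=\langle\mathcal O,\mathcal P\rangle$ of an ontology, that is, a set of description logic axioms $\varphi$ each with a first-order translation $\kappa(\varphi)$ (and $\mathsf{pr}(\varphi)=\mathsf{pr}(\kappa(\varphi))$), and a program. Put $\pi(p)=\mathbf Kp$, $\pi({\sim}p)=\mathbf{not}\,p$, $\pi(r)=\bigl(\bigwedge_{L\in B(r)}\pi(L)\supset\pi(H(r))\bigr)$, $\pi(\mathcal K)=\{\mathbf K\kappa(\varphi)\mid\varphi\in\mathcal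 O\}\cup\{\pi(r)\mid r\in\mathcal P\}$. An MKNF model of $\mathcal K$ is an MKNF model of $\pi(\mathcal K)$. A dynamic hybrid knowledge base is a finite sequence of hybrid knowledge bases. *Splitting.* $U\subseteq\mathbf P$ is a splitting set for $\mathcal K$ if $\mathsf{pr}(\varphi)\subseteq U$ for all $\varphi\in\mathcal O$ with $\mathsf{pr}(\varphi)\cap U\ne\emptyset$, and $\mathsf{pr}(r)\subseteq U$ for all $r\in\mathcal P$ with $\mathsf{pr}(H(r))\cap U\neq\emptyset$. The bottom $b_U(\mathcal K)$ consists of the axioms and rules of $\mathcal K$ with all predicate symbols in $U$, the top $t_U(\mathcal K)$ of the others. For $X\subseteq\mathcal I$, the reduct $e_U(\mathcal K,X)$ has the ontology of $t_U(\mathcal K)$ and all rules $r'$ for which there is a rule $r$ of $t_U(\mathcal K)$ with $X\models\{\pi(L)\mid L\in B(r),\ \mathsf{pr}(L)\subseteq U\}$, $H(r')=H(r)$ and $B(r')=\{L\in B(r)\mid\mathsf{pr}(L)\subseteq\mathbf P\setminus U\}$. A splitting sequence for $\mathcal K$ is a nonempty monotone sequence $\langle U_\alpha\rangle_{\alpha<\mu}$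 of splitting sets for $\mathcal K$, indexed by the ordinals below an ordinal $\mu$, with $U_\alpha=\bigcup_{\beta<\alpha}U_\beta$ at limit ordinals $\alpha<\mu$ and with $\bigcup_{\alpha<\mu}U_\alpha=\mathbf P$. $\mathcal K$ is reducible relative to $U$ if either all its rules are positive with $\mathsf{pr}(B(r))\subseteq U$, or its ontology is empty; a sequence of knowledge bases is reducible relative to $U$ if the first alternative holds for all its members or the second one does. The sequence $\langle U_\alpha\rangle_{\alpha<\mu}$ is update-enabling if $b_{U_0}(\mathcal K)$ is reducible relative to $\emptyset$ and $t_{U_\alpha}(b_{U_{\alpha+1}}(\mathcal K))$ is reducible relative to $U_\alpha$ whenever $\alpha+1<\mu$; $\mathcal K$ is updatable if it has an update-enabling splitting sequence. For dynamic hybrid knowledge bases, $b_U,t_U,e_U$ are taken memberwise, a splitting sequence has to be one for every member, and update-enabling and updatable are defined by the same words. *Updates of theories and programs.* For $I,J,J'\in\mathcal I$, $J\le_IJ'$ means that for every $P\in\mathbf P$ the set of atoms with predicate symbol $P$ on which $I,J$ differ is contained in the one on which $I,J'$ differ; $J<_IJ'$ means $J\le_IJ'$ and not $J'\le_IJ$.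 For $M,N\subseteq\mathcal I$ put $M\oplus N=\bigcup_{I\in M}\{J\in N\mid\text{no }J'\in N\text{ has }J'<_IJ\}$. The minimal change update model of first-order theories $\langle T_i\rangle_{i<n}$ is $(\cdots(\mathsf{mod}(T_0)\oplus\mathsf{mod}(T_1))\oplus\cdots)\oplus\mathsf{mod}(T_{n-1})$, provided that this set is nonempty. Given programs $\langle\mathcal P_i\rangle_{i<n}$ and $I\in\mathcal I$, an occurrence of a rule $r$ in $\mathcal P_i$ is rejected if some $\mathcal P_j$ with $i\le j$ contains a rule $r'$ with $H(r)={\sim}H(r')$ and $I\models B(r')$. $I$ is a dynamic stable model of $\langle\mathcal P_i\rangle_{i<n}$ if $I\cup\{\mathit{not}\_p\mid p\notin I\}$ is the least model of the program that consists of the rules with a non-rejected occurrence and the facts ${\sim}p$ for those atoms $p$ for which no rule $r$ of any $\mathcal P_i$ has $H(r)=p$ and $I\models B(r)$, every default literal ${\sim}p$ being read as a fresh atom $\mathit{not}\_p$. *Dynamic MKNF models.* A dynamic hybrid knowledge base $\langle\mathcal O_i,\mathcal P_i\rangle_{i<n}$ is $\mathcal O$-based if every $\mathcal P_i$ contains only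 positive facts, $\mathcal P$-based if every $\mathcal O_i$ is empty, and basic if it is one of the two. An MKNF interpretation $M$ is a dynamic MKNF model of a basic one if either it is $\mathcal O$-based and $M$ is the minimal change update model of $\langle\kappa(\mathcal O_i)\cup\mathcal P_i\rangle_{i<n}$ (positive facts being read as ground atoms), or it is $\mathcal P$-based and $M=\{J\in\mathcal I\mid I\subseteq J\}$ for some dynamic stable model $I$ of $\langle\mathcal P_i\rangle_{i<n}$. An MKNF interpretation $M$ is a dynamic MKNF model of an updatable dynamic hybrid knowledge base $\mathcal K$ if, for some update-enabling splitting sequence $\langle U_\alpha\rangle_{\alpha<\mu}$ for $\mathcal K$, $M=\bigcap_{\alpha<\mu}X_\alpha$ for some sequence of MKNF interpretations $\langle X_\alpha\rangle_{\alpha<\mu}$ such that $X_0$ is a dynamic MKNF model of $b_{U_0}(\mathcal K)$, $X_{\alpha+1}$ is a dynamic MKNF model of $e_{U_\alpha}\bigl(b_{U_{\alpha+1}}(\mathcal K),\bigcap_{\eta\le\alpha}X_\eta\bigr)$ whenever $\alpha+1<\mu$, and $X_\alpha=\mathcal I$ for limit ordinals $\alpha<\mu$. -/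

import Mathlib

universe u v w

namespace HybridMKNF

/-- A function-free first-order signature: predicate symbols with arities, and infinitely many
constants. By the standard names assumption the Herbrand universe is the set of constants. -/
structure Signature where
  Pred : Type u
  arity : Pred → ℕ
  Const : Type v
  const_infinite : Infinite Const

/-- Terms whose variables are among `n` variables (de Bruijn indices). -/
inductive Term (σ : Signature.{u, v}) (n : ℕ) : Type v
  | var (i : Fin n) : Term σ n
  | const (c : σ.Const) : Term σ n

/-- MKNF formulae whose free variables are among `n` variables (de Bruijn indices: in `ex φ` the
bound variable is the variable `0` of `φ`). `know` and `mnot` are the modal operators `K`, `not`. -/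
inductive Formula (σ : Signature.{u, v}) : ℕ → Type (max u v)
  | atom {n : ℕ} (P : σ.Pred) (t : Fin (σ.arity P) → Term σ n) : Formula σ n
  | neg {n : ℕ} (φ : Formula σ n) : Formula σ n
  | conj {n : ℕ} (φ ψ : Formula σ n) : Formula σ n
  | ex {n : ℕ} (φ : Formula σ (n + 1)) : Formula σ n
  | know {n : ℕ} (φ : Formula σ n) : Formula σ n
  | mnot {n : ℕ} (φ : Formula σ n) : Formula σ n

/-- MKNF sentences: formulae without free variables. -/
abbrev Sentence (σ : Signature.{u, v}) := Formula σ 0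

/-- Ground atoms. -/
structure GroundAtom (σ : Signature.{u, v}) where
  pred : σ.Pred
  args : Fin (σ.arity pred) → σ.Const

/-- Herbrand interpretations. An element of `Set (Interp σ)` is an MKNF interpretation if it is
nonempty. -/
abbrev Interp (σ : Signature.{u, v}) := Set (GroundAtom σ)

section Semantics

variable {σ : Signature.{u, v}}

/-- The value of a term when the variable `i` stands for the constant `e i`. -/
def Term.eval {n : ℕ} (e : Fin n → σ.Const) : Term σ n → σ.Const
  | .var i => e i
  | .const c => c

/-- The predicate symbols occurring in a formula. -/
def Formula.preds : {n : ℕ} → Formula σ n → Set σ.Pred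
  | _, .atom P _ => {P}
  | _, .neg φ => φ.preds
  | _, .conj φ ψ => φ.preds ∪ ψ.preds
  | _, .ex φ => φ.preds
  | _, .know φ => φ.preds
  | _, .mnot φ => φ.preds

/-- A formula is first-order if it contains no modal operator. -/
def Formula.IsFirstOrder : {n : ℕ} → Formula σ n → Prop
  | _, .atom _ _ => True
  | _, .neg φ => φ.IsFirstOrder
  | _, .conj φ ψ => φ.IsFirstOrder ∧ ψ.IsFirstOrder
  | _, .ex φ => φ.IsFirstOrder
  | _, .know _ => False
  | _, .mnot _ => False

/-- `φ.Sat e I M N`: the MKNF structure `(I, M, N)` satisfies the sentence obtained from `φ` by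
replacing every free variable `i` by the constant `e i`. -/
def Formula.Sat : {n : ℕ} → Formula σ n → (Fin n → σ.Const) →
    Interp σ → Set (Interp σ) → Set (Interp σ) → Prop
  | _, .atom P t, e, I, _, _ => (⟨P, fun i => (t i).eval e⟩ : GroundAtom σ) ∈ I
  | _, .neg φ, e, I, M, N => ¬ φ.Sat e I M N
  | _, .conj φ ψ, e, I, M, N => φ.Sat e I M N ∧ ψ.Sat e I M N
  | _, .ex φ, e, I, M, N => ∃ c : σ.Const, φ.Sat (Fin.cons c e) I M N
  | _, .know φ, e, _, M, N => ∀ J ∈ M, φ.Sat e J M N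
  | _, .mnot φ, e, _, M, N => ∃ J ∈ N, ¬ φ.Sat e J M N

/-- Satisfaction of a sentence in the MKNF structure `(I, M, N)`. -/
def Sentence.Holds (φ : Sentence σ) (I : Interp σ) (M N : Set (Interp σ)) : Prop :=
  Formula.Sat φ Fin.elim0 I M N

/-- `M ⊨ T`, for a possibly empty set `M` of interpretations. -/
def Entails (M : Set (Interp σ)) (T : Set (Sentence σ)) : Prop :=
  ∀ φ ∈ T, ∀ I ∈ M, Sentence.Holds φ I M M

/-- `M` is an S5 model of `T`. -/
def IsS5Model (T : Set (Sentence σ)) (M : Set (Interp σ)) : Prop :=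
  M.Nonempty ∧ Entails M T

/-- `M` is an MKNF model of `T`. -/
def IsMKNFModel (T : Set (Sentence σ)) (M : Set (Interp σ)) : Prop :=
  IsS5Model T M ∧
    ∀ M' : Set (Interp σ), M'.Nonempty → M ⊂ M' →
      ∃ I' ∈ M', ∃ φ ∈ T, ¬ Sentence.Holds φ I' M' M

/-- `mod T`, the greatest `M` with `M ⊨ T` if there is one (it is then the union of all of them);
there is one for every first-order theory, see `isGreatest_modelSet`. -/
def modelSet (T : Set (Sentence σ)) : Set (Interp σ) :=
  ⋃₀ {M | Entails M T}

theorem Formula.IsFirstOrder.sat_iff {n : ℕ} {φ : Formula σ n} (h : φ.IsFirstOrder)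
    (e : Fin n → σ.Const) (I : Interp σ) (M N M' N' : Set (Interp σ)) :
    φ.Sat e I M N ↔ φ.Sat e I M' N' := by
  induction φ with
  | atom P t => exact Iff.rfl
  | neg φ ih => exact not_congr (ih h e)
  | conj φ ψ ih₁ ih₂ => exact and_congr (ih₁ h.1 e) (ih₂ h.2 e)
  | ex φ ih => exact exists_congr fun c => ih h _
  | know φ ih => exact h.elim
  | mnot φ ih => exact h.elim

theorem isGreatest_modelSet {T : Set (Sentence σ)} (hT : ∀ φ ∈ T, Formula.IsFirstOrder φ) :
    IsGreatest {M | Entails M T} (modelSet T) := by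
  refine ⟨?_, fun M hM => Set.subset_sUnion_of_mem hM⟩
  rintro φ hφ I ⟨M, hM, hI⟩
  exact ((hT φ hφ).sat_iff _ I M M _ _).1 (hM φ hφ I hI)

end Semantics

section MinimalChange

variable {σ : Signature.{u, v}}

/-- The atoms of `I` with predicate symbol `P`. -/
def restrictPred (P : σ.Pred) (I : Interp σ) : Interp σ := {p ∈ I | p.pred = P}

/-- The difference in the interpretation of `P` between `I` and `J`. -/
def predDiff (P : σ.Pred) (I J : Interp σ) : Interp σ :=
  (restrictPred P I \ restrictPred P J) ∪ (restrictPred P J \ restrictPred P I)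

/-- `J` is at least as close to `I` as `J'`. -/
def CloserEq (I J J' : Interp σ) : Prop := ∀ P : σ.Pred, predDiff P I J ⊆ predDiff P I J'

/-- `J` is closer to `I` than `J'`. -/
def Closer (I J J' : Interp σ) : Prop := CloserEq I J J' ∧ ¬ CloserEq I J' J

/-- `M ⊕ N`: those members of `N` that are closest to some member of `M`. -/
def update (M N : Set (Interp σ)) : Set (Interp σ) :=
  ⋃ I ∈ M, {J ∈ N | ¬ ∃ J' ∈ N, Closer I J' J}

/-- `mod ⟨T₀, …, Tₙ₋₁⟩ = (⋯(mod T₀ ⊕ mod T₁) ⊕ ⋯) ⊕ mod Tₙ₋₁`, with the set of all interpretations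
as the starting point (note that `Set.univ ⊕ N = N`). -/
def minimalChange (T : List (Set (Sentence σ))) : Set (Interp σ) :=
  (T.map modelSet).foldl update Set.univ

end MinimalChange

/-- Literals: ground atoms and default literals. -/
inductive Literal (σ : Signature.{u, v}) : Type (max u v)
  | pos (p : GroundAtom σ) : Literal σ
  | dneg (p : GroundAtom σ) : Literal σ

/-- A rule `head ← L₁, …, Lₖ`. -/
structure Rule (σ : Signature.{u, v}) where
  head : Literal σ
  bodyList : List (Literal σ)

/-- Generalised logic programs. -/
abbrev Program (σ : Signature.{u, v}) := Set (Rule σ)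

section Programs

variable {σ : Signature.{u, v}}

/-- The atom underlying a literal. -/
def Literal.base : Literal σ → GroundAtom σ
  | .pos p => p
  | .dneg p => p

/-- Default negation of a literal; double default negation is absorbed. -/
def Literal.compl : Literal σ → Literal σ
  | .pos p => .dneg p
  | .dneg p => .pos p

/-- The set of predicate symbols of a literal. -/
def Literal.preds (L : Literal σ) : Set σ.Pred := {L.base.pred}

/-- Truth of a literal in a Herbrand interpretation. -/
def Literal.TrueIn (I : Interp σ) : Literal σ → Prop
  | .pos p => p ∈ I
  | .dneg p => p ∉ I

/-- The body of a rule, as a set. -/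
def Rule.body (r : Rule σ) : Set (Literal σ) := {L | L ∈ r.bodyList}

/-- The set of predicate symbols of a set of literals. -/
def litPreds (B : Set (Literal σ)) : Set σ.Pred := ⋃ L ∈ B, L.preds

/-- The set of predicate symbols of a rule. -/
def Rule.preds (r : Rule σ) : Set σ.Pred := r.head.preds ∪ litPreds r.body

/-- A rule is positive if its head is an atom. -/
def Rule.IsPositive (r : Rule σ) : Prop := ∃ p, r.head = Literal.pos p

/-- A rule is a fact if its body is empty. -/
def Rule.IsFact (r : Rule σ) : Prop := r.bodyList = []

/-- Two rules are conflicting if the head of one is the default negation of the head of the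
other. -/
def Rule.Conflicts (r r' : Rule σ) : Prop := r.head = r'.head.compl

/-- `I ⊨ B`. -/
def SatBody (I : Interp σ) (B : Set (Literal σ)) : Prop := ∀ L ∈ B, L.TrueIn I

/-- The least model of a program in which every default literal `not p` is read as a new atom
`not_p`. The literals themselves serve as the extended set of atoms. -/
def leastModel (P : Program σ) : Set (Literal σ) :=
  ⋂₀ {S | ∀ r ∈ P, r.body ⊆ S → r.head ∈ S}

/-- `I ∪ {not_p | p ∉ I}`. -/
def extendInterp (I : Interp σ) : Set (Literal σ) := {L | L.TrueIn I}

/-- The occurrence of the rule `r` in the `i`-th program is rejected: a conflicting rule of the same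
or of a later program has a body that is true in `I`. -/
def IsRejected (P : List (Program σ)) (I : Interp σ) (i : Fin P.length) (r : Rule σ) : Prop :=
  ∃ j : Fin P.length, i ≤ j ∧ ∃ r' ∈ P.get j, r.Conflicts r' ∧ SatBody I r'.body

/-- The rules with an occurrence that is not rejected. -/
def survivingRules (P : List (Program σ)) (I : Interp σ) : Program σ :=
  {r | ∃ i : Fin P.length, r ∈ P.get i ∧ ¬ IsRejected P I i r}

/-- The default assumptions `not p`, as facts: those for which no rule with head `p` has a body that
is true in `I`. -/
def defaultFacts (P : List (Program σ)) (I : Interp σ) : Program σ :=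
  {r | r.IsFact ∧ ∃ p, r.head = Literal.dneg p ∧
    ¬ ∃ i : Fin P.length, ∃ r' ∈ P.get i, r'.head = Literal.pos p ∧ SatBody I r'.body}

/-- `I` is a dynamic stable model of the dynamic logic program `P`. -/
def IsDynamicStableModel (P : List (Program σ)) (I : Interp σ) : Prop :=
  extendInterp I = leastModel (survivingRules P I ∪ defaultFacts P I)

/-- A ground atom as a sentence. -/
def GroundAtom.toSentence (p : GroundAtom σ) : Sentence σ :=
  .atom p.pred fun i => .const (p.args i)

/-- `π(p) = K p` and `π(not p) = not p`. -/
def Literal.trans : Literal σ → Sentence σ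
  | .pos p => .know p.toSentence
  | .dneg p => .mnot p.toSentence

/-- `π(r)`, the sentence `π(head) ⊂ ⋀ π(body)`, written with negation and conjunction as
`¬(π(L₁) ∧ (π(L₂) ∧ ⋯ (π(Lₖ) ∧ ¬π(head))))`. -/
def Rule.trans (r : Rule σ) : Sentence σ :=
  .neg (r.bodyList.foldr (fun L φ => .conj L.trans φ) (.neg r.head.trans))

end Programs

/-- The description logic in use: its ontology axioms and their first-order translation. -/
structure DescriptionLogic (σ : Signature.{u, v}) where
  Ax : Type w
  fo : Ax → Sentence σ
  fo_isFirstOrder : ∀ a, Formula.IsFirstOrder (fo a)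

/-- A hybrid knowledge base: an ontology and a generalised logic program. -/
structure HybridKB {σ : Signature.{u, v}} (D : DescriptionLogic.{u, v, w} σ) where
  ont : Set D.Ax
  prog : Program σ

/-- A dynamic hybrid knowledge base. -/
abbrev DynamicKB {σ : Signature.{u, v}} (D : DescriptionLogic.{u, v, w} σ) := List (HybridKB D)

/-- The predicate symbols of an ontology axiom. -/
def DescriptionLogic.preds {σ : Signature.{u, v}} (D : DescriptionLogic.{u, v, w} σ)
    (a : D.Ax) : Set σ.Pred := Formula.preds (D.fo a)

namespace HybridKB

variable {σ : Signature.{u, v}} {D : DescriptionLogic.{u, v, w} σ}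

/-- The set `π(K)` of MKNF sentences. -/
def trans (K : HybridKB D) : Set (Sentence σ) :=
  {φ | ∃ a ∈ K.ont, φ = .know (D.fo a)} ∪ {φ | ∃ r ∈ K.prog, φ = r.trans}

/-- `M` is an MKNF model of the hybrid knowledge base `K`. -/
def IsModel (K : HybridKB D) (M : Set (Interp σ)) : Prop := IsMKNFModel K.trans M

/-- `U` is a splitting set for `K`. -/
def IsSplittingSet (K : HybridKB D) (U : Set σ.Pred) : Prop :=
  (∀ a ∈ K.ont, (D.preds a ∩ U).Nonempty → D.preds a ⊆ U) ∧
    ∀ r ∈ K.prog, (r.head.preds ∩ U).Nonempty → r.preds ⊆ U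

/-- The bottom of `K` relative to `U`. -/
def bottom (U : Set σ.Pred) (K : HybridKB D) : HybridKB D where
  ont := {a ∈ K.ont | D.preds a ⊆ U}
  prog := {r ∈ K.prog | r.preds ⊆ U}

/-- The top of `K` relative to `U`. -/
def top (U : Set σ.Pred) (K : HybridKB D) : HybridKB D where
  ont := K.ont \ (K.bottom U).ont
  prog := K.prog \ (K.bottom U).prog

/-- The splitting set reduct of `K` relative to `U` and `X`. -/
def reduct (U : Set σ.Pred) (X : Set (Interp σ)) (K : HybridKB D) : HybridKB D where
  ont := (K.top U).ont
  prog := {r' | ∃ r ∈ (K.top U).prog,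
    Entails X (Literal.trans '' {L ∈ r.body | L.preds ⊆ U}) ∧
    r'.head = r.head ∧ r'.body = {L ∈ r.body | L.preds ⊆ Uᶜ}}

/-- The program of `K` contains only positive facts. -/
def OntBased (K : HybridKB D) : Prop := ∀ r ∈ K.prog, r.IsPositive ∧ r.IsFact

/-- The ontology of `K` is empty. -/
def ProgBased (K : HybridKB D) : Prop := K.ont = ∅

def OntReducible (K : HybridKB D) (U : Set σ.Pred) : Prop :=
  ∀ r ∈ K.prog, r.IsPositive ∧ litPreds r.body ⊆ U

/-- This does not depend on the set of predicate symbols. -/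
def ProgReducible (K : HybridKB D) (_U : Set σ.Pred) : Prop := K.ont = ∅

def Reducible (K : HybridKB D) (U : Set σ.Pred) : Prop :=
  K.OntReducible U ∨ K.ProgReducible U

/-- The first-order theory of an ontology-based knowledge base: the translated axioms, and the
positive facts read as ground atoms. -/
def foTheory (K : HybridKB D) : Set (Sentence σ) :=
  D.fo '' K.ont ∪
    {φ | ∃ r ∈ K.prog, ∃ p, r.head = Literal.pos p ∧ r.IsFact ∧ φ = p.toSentence}

/-- `⟨U α⟩_{α < μ}` is a splitting sequence for `K`: a nonempty monotone and continuous sequence of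
splitting sets with union the set of all predicate symbols. Values `U α` with `μ ≤ α` play no
role. -/
structure IsSplittingSequence (K : HybridKB D) (μ : Ordinal.{u}) (U : Ordinal.{u} → Set σ.Pred) :
    Prop where
  pos : 0 < μ
  splitting : ∀ α < μ, K.IsSplittingSet (U α)
  monotone : ∀ α β, α ≤ β → β < μ → U α ⊆ U β
  continuous : ∀ α < μ, Order.IsSuccLimit α → U α = ⋃ β < α, U β
  exhaustive : ⋃ α < μ, U α = Set.univ

/-- `⟨U α⟩_{α < μ}` is an update-enabling splitting sequence for `K`. -/
structure IsUpdateEnabling (K : HybridKB D) (μ : Ordinal.{u}) (U : Ordinal.{u} → Set σ.Pred) :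
    Prop where
  isSplittingSequence : K.IsSplittingSequence μ U
  zero : (K.bottom (U 0)).Reducible ∅
  succ : ∀ α, α + 1 < μ → ((K.bottom (U (α + 1))).top (U α)).Reducible (U α)

/-- `K` is updatable. -/
def Updatable (K : HybridKB D) : Prop :=
  ∃ (μ : Ordinal.{u}) (U : Ordinal.{u} → Set σ.Pred), K.IsUpdateEnabling μ U

end HybridKB

namespace DynamicKB

variable {σ : Signature.{u, v}} {D : DescriptionLogic.{u, v, w} σ}

def bottom (U : Set σ.Pred) (K : DynamicKB D) : DynamicKB D := K.map (HybridKB.bottom U)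

def top (U : Set σ.Pred) (K : DynamicKB D) : DynamicKB D := K.map (HybridKB.top U)

def reduct (U : Set σ.Pred) (X : Set (Interp σ)) (K : DynamicKB D) : DynamicKB D :=
  K.map (HybridKB.reduct U X)

def OntBased (K : DynamicKB D) : Prop := ∀ k ∈ K, k.OntBased

def ProgBased (K : DynamicKB D) : Prop := ∀ k ∈ K, k.ProgBased

def Reducible (K : DynamicKB D) (U : Set σ.Pred) : Prop :=
  (∀ k ∈ K, k.OntReducible U) ∨ (∀ k ∈ K, k.ProgReducible U)

/-- `M` is a dynamic MKNF model of the basic dynamic hybrid knowledge base `K` (no `M` is one if `K`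
is not basic). -/
def IsBasicDynamicModel (K : DynamicKB D) (M : Set (Interp σ)) : Prop :=
  M.Nonempty ∧
    ((OntBased K ∧ M = minimalChange (K.map HybridKB.foTheory)) ∨
      (ProgBased K ∧ ∃ I : Interp σ,
        IsDynamicStableModel (K.map HybridKB.prog) I ∧ M = {J | I ⊆ J}))

/-- `⟨U α⟩_{α < μ}` is an update-enabling splitting sequence for `K`. -/
structure IsUpdateEnabling (K : DynamicKB D) (μ : Ordinal.{u}) (U : Ordinal.{u} → Set σ.Pred) :
    Prop where
  isSplittingSequence : ∀ k ∈ K, k.IsSplittingSequence μ U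
  zero : Reducible (bottom (U 0) K) ∅
  succ : ∀ α, α + 1 < μ → Reducible (top (U α) (bottom (U (α + 1)) K)) (U α)

/-- `⟨X α⟩_{α < μ}` is a solution to `K` with respect to `⟨U α⟩_{α < μ}`. -/
structure IsSolution (K : DynamicKB D) (μ : Ordinal.{u}) (U : Ordinal.{u} → Set σ.Pred)
    (X : Ordinal.{u} → Set (Interp σ)) : Prop where
  nonempty : ∀ α < μ, (X α).Nonempty
  zero : IsBasicDynamicModel (bottom (U 0) K) (X 0)
  succ : ∀ α, α + 1 < μ →
    IsBasicDynamicModel (reduct (U α) (⋂ η ≤ α, X η) (bottom (U (α + 1)) K)) (X (α + 1))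
  limit : ∀ α < μ, Order.IsSuccLimit α → X α = Set.univ

/-- `M` is a dynamic MKNF model of `K` with respect to `⟨U α⟩_{α < μ}`. -/
def IsDynamicModelWrt (K : DynamicKB D) (μ : Ordinal.{u}) (U : Ordinal.{u} → Set σ.Pred)
    (M : Set (Interp σ)) : Prop :=
  M.Nonempty ∧ ∃ X : Ordinal.{u} → Set (Interp σ), IsSolution K μ U X ∧ M = ⋂ α < μ, X α

/-- `M` is a dynamic MKNF model of the updatable dynamic hybrid knowledge base `K`. -/
def IsDynamicModel (K : DynamicKB D) (M : Set (Interp σ)) : Prop :=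
  ∃ (μ : Ordinal.{u}) (U : Ordinal.{u} → Set σ.Pred),
    IsUpdateEnabling K μ U ∧ IsDynamicModelWrt K μ U M

end DynamicKB

end HybridMKNF

/-! An update-enabling splitting sequence gives every predicate symbol a rank, the least index at
which it appears. Splitting says that an axiom uses symbols of a single rank and that no body
literal of a rule outranks the head. So the knowledge base falls into layers: layer `α` has the
axioms of rank `α` and the rules with head of rank `α`, their lower body literals already evaluated.
The bottom and the reducts in the definition of a solution are exactly these layers, and a limit
index has the empty layer, whose only MKNF model is `Set.univ`.

Two facts then suffice. On one layer the notions agree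
(`DynamicKB.isBasicDynamicModel_singleton_iff`), since update-enabling makes each layer basic. A
single ontology-based member is not changed by updating, and both notions give the models of its
theory. For a single program, MKNF models are the upsets of stable models, which are the dynamic
stable models of a one-element sequence.

The layers are independent enough to be glued. If the `X α` are models of the layers and meet, their
intersection is a model of `K` (`HybridKB.isModel_iInter_of_isLayer`). Conversely, a model `M` of
`K` is the intersection of its saturations by rank, and these are models of the layers
(`HybridKB.IsModel.eq_iInter_saturate`, `HybridKB.IsModel.isModel_saturate`). Both directions work
for every update-enabling sequence. -/

namespace HybridMKNF

/-! ### MKNF models with the modal operators evaluated -/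

section PairSemantics

variable {σ : Signature.{u, v}} {D : DescriptionLogic.{u, v, w} σ}

/-- Truth of `π(L)` in a structure `(I, M', M)`, which does not depend on `I`. -/
def Literal.SatIn (M' M : Set (Interp σ)) : Literal σ → Prop
  | .pos p => ∀ J ∈ M', p ∈ J
  | .dneg p => ∃ J ∈ M, p ∉ J

theorem Literal.holds_trans (L : Literal σ) (I : Interp σ) (M' M : Set (Interp σ)) :
    Sentence.Holds L.trans I M' M ↔ L.SatIn M' M := by
  cases L <;> exact Iff.rfl

theorem Rule.holds_trans (r : Rule σ) (I : Interp σ) (M' M : Set (Interp σ)) :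
    Sentence.Holds r.trans I M' M ↔ ((∀ L ∈ r.body, L.SatIn M' M) → r.head.SatIn M' M) := by
  have key : ∀ l : List (Literal σ),
      Formula.Sat (l.foldr (fun L φ => Formula.conj L.trans φ) (.neg r.head.trans))
        Fin.elim0 I M' M ↔ (∀ L ∈ l, L.SatIn M' M) ∧ ¬ r.head.SatIn M' M := by
    intro l
    induction l with
    | nil =>
      simp only [List.foldr_nil, List.not_mem_nil, false_imp_iff, implies_true, true_and]
      exact not_congr (r.head.holds_trans I M' M)
    | cons L l ih =>
      rw [List.foldr_cons, List.forall_mem_cons, and_assoc, ← ih]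
      exact and_congr_left' (L.holds_trans I M' M)
  unfold Rule.trans Sentence.Holds
  change ¬ Formula.Sat _ _ _ _ _ ↔ _
  rw [key]
  simp only [Rule.body, Set.mem_ofPred_eq]
  tauto

/-- Enlarging the first component makes fewer literals true. -/
theorem Literal.SatIn.anti {L : Literal σ} {M₁ M₂ M : Set (Interp σ)} (h : L.SatIn M₂ M)
    (hs : M₁ ⊆ M₂) : L.SatIn M₁ M := by
  cases L with
  | pos p => exact fun J hJ => h J (hs hJ)
  | dneg p => exact h

/-- `(I, M', M)` satisfies `π(K)` for all `I ∈ M'`, the modal operators being evaluated. -/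
def HybridKB.PairSat (K : HybridKB D) (M' M : Set (Interp σ)) : Prop :=
  (∀ a ∈ K.ont, ∀ I ∈ M', Sentence.Holds (D.fo a) I ∅ ∅) ∧
    ∀ r ∈ K.prog, (∀ L ∈ r.body, L.SatIn M' M) → r.head.SatIn M' M

/-- Sentences of `π(K)` are modal, so their truth does not depend on the interpretation `I`. One
member of `M'` is needed to read it off. -/
theorem HybridKB.pairSat_iff (K : HybridKB D) {M' : Set (Interp σ)} (hM' : M'.Nonempty)
    (M : Set (Interp σ)) :
    K.PairSat M' M ↔ ∀ φ ∈ K.trans, ∀ I ∈ M', Sentence.Holds φ I M' M := by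
  obtain ⟨I₀, hI₀⟩ := hM'
  constructor
  · rintro ⟨h₁, h₂⟩ φ (⟨a, ha, rfl⟩ | ⟨r, hr, rfl⟩) I _
    · exact fun J hJ => ((D.fo_isFirstOrder a).sat_iff _ J _ _ _ _).1 (h₁ a ha J hJ)
    · exact (r.holds_trans I M' M).2 (h₂ r hr)
  · intro h
    refine ⟨fun a ha I hI => ?_, fun r hr => ?_⟩
    · exact ((D.fo_isFirstOrder a).sat_iff _ I _ _ _ _).1
        (h _ (Or.inl ⟨a, ha, rfl⟩) I₀ hI₀ I hI)
    · exact (r.holds_trans I₀ M' M).1 (h _ (Or.inr ⟨r, hr, rfl⟩) I₀ hI₀)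

theorem HybridKB.isModel_iff (K : HybridKB D) (M : Set (Interp σ)) :
    K.IsModel M ↔
      M.Nonempty ∧ K.PairSat M M ∧ ∀ M', M ⊆ M' → K.PairSat M' M → M' ⊆ M := by
  constructor
  · rintro ⟨⟨hne, hs⟩, hmax⟩
    refine ⟨hne, (K.pairSat_iff hne M).2 hs, fun M' hMM' hp => ?_⟩
    by_contra hn
    have hne' := hne.mono hMM'
    obtain ⟨I', hI', φ, hφ, hnot⟩ := hmax M' hne' ⟨hMM', hn⟩
    exact hnot ((K.pairSat_iff hne' M).1 hp φ hφ I' hI')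
  · rintro ⟨hne, hs, hmax⟩
    refine ⟨⟨hne, (K.pairSat_iff hne M).1 hs⟩, fun M' hne' hss => ?_⟩
    by_contra! hn
    exact hss.2 (hmax M' hss.1 ((K.pairSat_iff hne' M).2 fun φ hφ I hI => hn I hI φ hφ))

end PairSemantics

/-! ### Restriction of MKNF interpretations to a set of predicate symbols -/

section Saturation

variable {σ : Signature.{u, v}} {D : DescriptionLogic.{u, v, w} σ}

/-- `I` and `J` contain the same atoms with predicate symbols from `V`. -/
def AgreeOn (V : Set σ.Pred) (I J : Interp σ) : Prop :=
  ∀ p : GroundAtom σ, p.pred ∈ V → (p ∈ I ↔ p ∈ J)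

theorem AgreeOn.symm {V : Set σ.Pred} {I J : Interp σ} (h : AgreeOn V I J) : AgreeOn V J I :=
  fun p hp => (h p hp).symm

theorem AgreeOn.sat_iff {n : ℕ} {φ : Formula σ n} {V : Set σ.Pred} {I J : Interp σ}
    (h : AgreeOn V I J) (hφ : φ.IsFirstOrder) (hV : φ.preds ⊆ V) (e : Fin n → σ.Const)
    (M N : Set (Interp σ)) : φ.Sat e I M N ↔ φ.Sat e J M N := by
  induction φ with
  | atom P t => exact h _ (hV rfl)
  | neg φ ih => exact not_congr (ih hφ hV e)
  | conj φ ψ ih₁ ih₂ =>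
    exact and_congr (ih₁ hφ.1 (Set.subset_union_left.trans hV) e)
      (ih₂ hφ.2 (Set.subset_union_right.trans hV) e)
  | ex φ ih => exact exists_congr fun c => ih hφ hV _
  | know φ ih => exact hφ.elim
  | mnot φ ih => exact hφ.elim

theorem Formula.preds_nonempty {n : ℕ} (φ : Formula σ n) : φ.preds.Nonempty := by
  induction φ with
  | atom P t => exact ⟨P, rfl⟩
  | neg φ ih => exact ih
  | conj φ ψ ih₁ ih₂ => exact ih₁.mono Set.subset_union_left
  | ex φ ih => exact ih
  | know φ ih => exact ih
  | mnot φ ih => exact ih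

/-- The interpretations that agree on `V` with a member of `M`. -/
def saturate (V : Set σ.Pred) (M : Set (Interp σ)) : Set (Interp σ) :=
  {J | ∃ I ∈ M, AgreeOn V I J}

theorem subset_saturate (V : Set σ.Pred) (M : Set (Interp σ)) : M ⊆ saturate V M :=
  fun I hI => ⟨I, hI, fun _ _ => Iff.rfl⟩

/-- `J` on `V` and `I` elsewhere. -/
def glue (V : Set σ.Pred) (J I : Interp σ) : Interp σ :=
  {p | (p.pred ∈ V ∧ p ∈ J) ∨ (p.pred ∉ V ∧ p ∈ I)}

theorem agreeOn_glue (V : Set σ.Pred) (J I : Interp σ) : AgreeOn V J (glue V J I) := by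
  intro p hp
  simp [glue, hp]

theorem agreeOn_glue_compl {V W : Set σ.Pred} (h : Disjoint W V) (J I : Interp σ) :
    AgreeOn W I (glue V J I) := by
  intro p hp
  simp [glue, Set.disjoint_left.1 h hp]

theorem Literal.satIn_saturate {L : Literal σ} {V : Set σ.Pred} (hL : L.base.pred ∈ V)
    (M' M : Set (Interp σ)) :
    L.SatIn (saturate V M') (saturate V M) ↔ L.SatIn M' M := by
  cases L with
  | pos p =>
    refine ⟨fun h J hJ => h J (subset_saturate V M' hJ), ?_⟩
    rintro h J ⟨I, hI, hIJ⟩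
    exact (hIJ p hL).1 (h I hI)
  | dneg p =>
    constructor
    · rintro ⟨J, ⟨I, hI, hIJ⟩, hJ⟩
      exact ⟨I, hI, fun h => hJ ((hIJ p hL).1 h)⟩
    · rintro ⟨J, hJ, hp⟩
      exact ⟨J, subset_saturate V M hJ, hp⟩

/-- A set between `M` and its saturation has the same traces on `V` as `M`. This is the tool for
changing the set in which literals are evaluated. -/
theorem Literal.satIn_of_between {L : Literal σ} {V : Set σ.Pred} (hL : L.base.pred ∈ V)
    {M M₁ M₂ : Set (Interp σ)} (h₁ : M ⊆ M₁) (h₁' : M₁ ⊆ saturate V M)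
    (h₂ : M ⊆ M₂) (h₂' : M₂ ⊆ saturate V M) : L.SatIn M₁ M₂ ↔ L.SatIn M M := by
  cases L with
  | pos p =>
    refine ⟨fun h J hJ => h J (h₁ hJ), fun h J hJ => ?_⟩
    obtain ⟨I, hI, hIJ⟩ := h₁' hJ
    exact (hIJ p hL).1 (h I hI)
  | dneg p =>
    constructor
    · rintro ⟨J, hJ, hp⟩
      obtain ⟨I, hI, hIJ⟩ := h₂' hJ
      exact ⟨I, hI, fun h => hp ((hIJ p hL).1 h)⟩
    · rintro ⟨J, hJ, hp⟩
      exact ⟨J, h₂ hJ, hp⟩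

theorem holds_of_mem_saturate {a : D.Ax} {V : Set σ.Pred} (ha : D.preds a ⊆ V)
    {M : Set (Interp σ)} (h : ∀ I ∈ M, Sentence.Holds (D.fo a) I ∅ ∅) {J : Interp σ}
    (hJ : J ∈ saturate V M) : Sentence.Holds (D.fo a) J ∅ ∅ := by
  obtain ⟨I, hI, hIJ⟩ := hJ
  exact (hIJ.sat_iff (D.fo_isFirstOrder a) ha _ _ _).1 (h I hI)

/-- All predicate symbols of `K` are in `V`. -/
def HybridKB.PredsIn (K : HybridKB D) (V : Set σ.Pred) : Prop :=
  (∀ a ∈ K.ont, D.preds a ⊆ V) ∧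
    ∀ r ∈ K.prog, r.head.base.pred ∈ V ∧ ∀ L ∈ r.body, L.base.pred ∈ V

/-- MKNF models say nothing about predicate symbols that do not occur. -/
theorem HybridKB.IsModel.saturate_subset {K : HybridKB D} {M : Set (Interp σ)} {V : Set σ.Pred}
    (h : K.IsModel M) (hV : K.PredsIn V) : saturate V M ⊆ M := by
  obtain ⟨_, hs, hmax⟩ := (K.isModel_iff M).1 h
  have hsub := subset_saturate V M
  refine hmax _ hsub ⟨fun a ha I hI => ?_, fun r hr hb => ?_⟩
  · exact holds_of_mem_saturate (hV.1 a ha) (hs.1 a ha) hI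
  · have hiff : ∀ L : Literal σ, L.base.pred ∈ V → (L.SatIn (saturate V M) M ↔ L.SatIn M M) :=
      fun L hL => Literal.satIn_of_between hL hsub subset_rfl subset_rfl hsub
    exact (hiff _ (hV.2 r hr).1).2
      (hs.2 r hr fun L hL => (hiff L ((hV.2 r hr).2 L hL)).1 (hb L hL))

end Saturation

/-! ### Models of a stratified knowledge base and of its layers -/

section Splitting

variable {σ : Signature.{u, v}} {D : DescriptionLogic.{u, v, w} σ} {ι : Type*}

/-- The predicate symbols of rank `α`. -/
def stratum (rank : σ.Pred → ι) (α : ι) : Set σ.Pred := {P | rank P = α}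

theorem disjoint_stratum (rank : σ.Pred → ι) {α β : ι} (h : α ≠ β) :
    Disjoint (stratum rank α) (stratum rank β) :=
  Set.disjoint_left.2 fun _ h₁ h₂ => h (Eq.trans (Eq.symm h₁) h₂)

/-- If all `X α` are determined by the predicate symbols of rank `α`, then their intersection,
when nonempty, has the same restriction to rank `α` as `X α`. -/
theorem saturate_stratum_iInter {rank : σ.Pred → ι} {X : ι → Set (Interp σ)}
    (hX : ∀ α, saturate (stratum rank α) (X α) ⊆ X α) (hne : (⋂ α, X α).Nonempty) (α : ι) :
    saturate (stratum rank α) (⋂ α, X α) = X α := by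
  apply Set.Subset.antisymm
  · rintro J ⟨I, hI, hIJ⟩
    exact hX α ⟨I, Set.mem_iInter.1 hI α, hIJ⟩
  · intro J hJ
    obtain ⟨I₀, hI₀⟩ := hne
    -- Each `X β` sees only stratum `β` of the glued interpretation, which comes from `J` if `β = α`
    -- and from `I₀` otherwise.
    refine ⟨glue (stratum rank α) J I₀, Set.mem_iInter.2 fun β => ?_,
      (agreeOn_glue _ J I₀).symm⟩
    by_cases h : β = α
    · subst h
      exact hX β ⟨J, hJ, agreeOn_glue _ J I₀⟩
    · exact hX β ⟨I₀, Set.mem_iInter.1 hI₀ β, agreeOn_glue_compl (disjoint_stratum rank h) J I₀⟩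

variable [LinearOrder ι]

/-- Axioms of `K` do not mix ranks, and the ranks in the body of a rule do not exceed the rank of
its head. -/
structure HybridKB.IsStratified (K : HybridKB D) (rank : σ.Pred → ι) : Prop where
  ont : ∀ a ∈ K.ont, ∃ α, D.preds a ⊆ stratum rank α
  prog : ∀ r ∈ K.prog, ∀ L ∈ r.body, rank L.base.pred ≤ rank r.head.base.pred

/-- `L` consists of the axioms of `K` of rank `α` and of the rules of `K` of rank `α`, simplified
by evaluating the body literals of lower rank in `M`. -/
structure HybridKB.IsLayer (K : HybridKB D) (rank : σ.Pred → ι) (M : Set (Interp σ)) (α : ι)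
    (L : HybridKB D) : Prop where
  ont : ∀ a, a ∈ L.ont ↔ a ∈ K.ont ∧ D.preds a ⊆ stratum rank α
  exists_rule : ∀ r' ∈ L.prog, ∃ r ∈ K.prog, r'.head = r.head ∧ rank r.head.base.pred = α ∧
    (∀ l ∈ r.body, rank l.base.pred < α → l.SatIn M M) ∧
    r'.body = {l ∈ r.body | l.base.pred ∈ stratum rank α}
  exists_reduced : ∀ r ∈ K.prog, rank r.head.base.pred = α →
    (∀ l ∈ r.body, rank l.base.pred < α → l.SatIn M M) →
    ∃ r' ∈ L.prog, r'.head = r.head ∧ r'.body = {l ∈ r.body | l.base.pred ∈ stratum rank α}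

theorem HybridKB.IsLayer.predsIn {K L : HybridKB D} {rank : σ.Pred → ι} {M : Set (Interp σ)}
    {α : ι} (h : K.IsLayer rank M α L) : L.PredsIn (stratum rank α) := by
  refine ⟨fun a ha => ((h.ont a).1 ha).2, fun r' hr' => ?_⟩
  obtain ⟨r, -, hhead, hα, -, hbody⟩ := h.exists_rule r' hr'
  refine ⟨by rw [hhead]; exact hα, fun l hl => ?_⟩
  rw [hbody] at hl
  exact hl.2

/-- Literals of rank `α` have the same truth value in the intersection as in `X α`, so satisfaction
of `K` is inherited from the layers. For maximality, a competitor `M'` is shown to lie in every `X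
α` by induction on `α`: its saturation at rank `α` competes with `X α` as a model of the layer. -/
theorem HybridKB.isModel_iInter_of_isLayer [WellFoundedLT ι] {K : HybridKB D}
    {rank : σ.Pred → ι} (hK : K.IsStratified rank) {X : ι → Set (Interp σ)}
    {L : ι → HybridKB D} (hne : (⋂ α, X α).Nonempty)
    (hL : ∀ α, K.IsLayer rank (⋂ α, X α) α (L α)) (hX : ∀ α, (L α).IsModel (X α)) :
    K.IsModel (⋂ α, X α) := by
  set M := ⋂ α, X α with hMdef
  have hsat : ∀ α, saturate (stratum rank α) M = X α :=
    saturate_stratum_iInter (fun α => (hX α).saturate_subset (hL α).predsIn) hne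
  have hMX : ∀ α, M ⊆ X α := fun α => Set.iInter_subset X α
  have hmod := fun α => ((L α).isModel_iff (X α)).1 (hX α)
  have hlit : ∀ l : Literal σ, l.SatIn (X (rank l.base.pred)) (X (rank l.base.pred)) ↔
      l.SatIn M M := fun l => by
    rw [← hsat]
    exact Literal.satIn_saturate (V := stratum rank (rank l.base.pred)) rfl M M
  refine (K.isModel_iff M).2 ⟨hne, ⟨fun a ha I hI => ?_, fun r hr hb => ?_⟩, ?_⟩
  · obtain ⟨α, hα⟩ := hK.ont a ha
    exact (hmod α).2.1.1 a (((hL α).ont a).2 ⟨ha, hα⟩) I (hMX α hI)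
  · obtain ⟨r', hr', hhead, hbody⟩ :=
      (hL _).exists_reduced r hr rfl fun l hl _ => hb l hl
    refine (hlit _).1 (hhead ▸ (hmod (rank r.head.base.pred)).2.1.2 r' hr' fun l hl => ?_)
    rw [hbody] at hl
    have : rank l.base.pred = rank r.head.base.pred := hl.2
    rw [← this]
    exact (hlit l).2 (hb l hl.1)
  · intro M' hMM' hp
    refine Set.subset_iInter fun α => ?_
    induction α using WellFoundedLT.induction with
    | ind α ih =>
    have hXN : X α ⊆ saturate (stratum rank α) M' := by
      rw [← hsat α]
      rintro J ⟨I, hI, hIJ⟩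
      exact ⟨I, hMM' hI, hIJ⟩
    refine (subset_saturate (stratum rank α) M').trans
      ((hmod α).2.2 _ hXN ⟨fun a ha I hI => ?_, fun r' hr' hb => ?_⟩)
    · have ha' := ((hL α).ont a).1 ha
      exact holds_of_mem_saturate ha'.2 (hp.1 a ha'.1) hI
    · obtain ⟨r, hr, hhead, hα, hlow, hbody⟩ := (hL α).exists_rule r' hr'
      have hlit' : ∀ l : Literal σ, l.base.pred ∈ stratum rank α →
          (l.SatIn (saturate (stratum rank α) M') (X α) ↔ l.SatIn M' M) := fun l hl => by
        rw [← hsat α]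
        exact Literal.satIn_saturate hl M' M
      rw [hhead]
      refine (hlit' _ hα).2 (hp.2 r hr fun l hl => ?_)
      rcases (hK.prog r hr l hl).lt_or_eq with h | h
      · rw [hα] at h
        have h₁ := hlow l hl h
        cases l with
        -- Passing from `M` to the larger `M'` could falsify a positive literal. The induction
        -- hypothesis excludes this at lower ranks. Default literals are evaluated in `M` anyway.
        | pos p => exact fun J hJ => (hlit (.pos p)).2 h₁ J (ih _ h hJ)
        | dneg p => exact h₁
      · have hl' : l.base.pred ∈ stratum rank α := h.trans hα
        exact (hlit' l hl').1 (hb l (by rw [hbody]; exact ⟨hl, hl'⟩))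

/-- By maximality: since neither axioms nor literals mix ranks, the intersection satisfies whatever
`M` does. -/
theorem HybridKB.IsModel.eq_iInter_saturate {K : HybridKB D}
    {rank : σ.Pred → ι} (hK : K.IsStratified rank) {M : Set (Interp σ)} (hM : K.IsModel M) :
    M = ⋂ α, saturate (stratum rank α) M := by
  obtain ⟨-, hs, hmax⟩ := (K.isModel_iff M).1 hM
  have hsub : M ⊆ ⋂ α, saturate (stratum rank α) M :=
    Set.subset_iInter fun α => subset_saturate _ M
  have hlit : ∀ l : Literal σ, l.SatIn (⋂ α, saturate (stratum rank α) M) M ↔ l.SatIn M M :=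
    fun l => Literal.satIn_of_between (V := stratum rank (rank l.base.pred)) rfl hsub
      (Set.iInter_subset _ _) subset_rfl (subset_saturate _ M)
  refine hsub.antisymm (hmax _ hsub ⟨fun a ha I hI => ?_, fun r hr hb => ?_⟩)
  · obtain ⟨α, hα⟩ := hK.ont a ha
    exact holds_of_mem_saturate hα (hs.1 a ha) (Set.mem_iInter.1 hI α)
  · exact (hlit _).2 (hs.2 r hr fun l hl => (hlit l).1 (hb l hl))

/-- A competitor `N` on layer `α` lifts to a competitor of `M` for the whole of `K`, so maximality
of `M` gives maximality on the layer. -/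
theorem HybridKB.IsModel.isModel_saturate {K L : HybridKB D}
    {rank : σ.Pred → ι} (hK : K.IsStratified rank) {M : Set (Interp σ)} (hM : K.IsModel M)
    {α : ι} (hL : K.IsLayer rank M α L) : L.IsModel (saturate (stratum rank α) M) := by
  obtain ⟨hne, hs, hmax⟩ := (K.isModel_iff M).1 hM
  have hle := hK.prog
  refine (L.isModel_iff _).2 ⟨hne.mono (subset_saturate _ M),
    ⟨fun a ha I hI => ?_, fun r' hr' hb => ?_⟩, fun N hN hp => ?_⟩
  · have ha' := (hL.ont a).1 ha
    exact holds_of_mem_saturate ha'.2 (hs.1 a ha'.1) hI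
  · obtain ⟨r, hr, hhead, hα, hlow, hbody⟩ := hL.exists_rule r' hr'
    rw [hhead]
    refine (Literal.satIn_saturate (V := stratum rank α) hα M M).2 (hs.2 r hr fun l hl => ?_)
    rcases (hle r hr l hl).lt_or_eq with h | h
    · exact hlow l hl (h.trans_eq hα)
    · have hl' : l.base.pred ∈ stratum rank α := h.trans hα
      exact (Literal.satIn_saturate hl' M M).1 (hb l (by rw [hbody]; exact ⟨hl, hl'⟩))
  -- `M'` behaves as `N` on stratum `α` and as `M` on all others.
  · set M' : Set (Interp σ) := {I | I ∈ saturate (stratum rank α) N ∧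
      ∀ β, β ≠ α → I ∈ saturate (stratum rank β) M} with hM'
    have hMM' : M ⊆ M' := fun I hI =>
      ⟨subset_saturate _ N (hN (subset_saturate _ M hI)), fun β _ => subset_saturate _ M hI⟩
    have hglue : ∀ J ∈ N, ∀ I ∈ M, glue (stratum rank α) J I ∈ M' := fun J hJ I hI =>
      ⟨⟨J, hJ, agreeOn_glue _ J I⟩, fun β hβ =>
        ⟨I, hI, agreeOn_glue_compl (disjoint_stratum rank hβ) J I⟩⟩
    have hlit : ∀ l : Literal σ, rank l.base.pred ≠ α → (l.SatIn M' M ↔ l.SatIn M M) :=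
      fun l hl => Literal.satIn_of_between (V := stratum rank (rank l.base.pred)) rfl hMM'
        (fun I hI => hI.2 _ hl) subset_rfl (subset_saturate _ M)
    obtain ⟨I₀, hI₀⟩ := hne
    have hlit' : ∀ l : Literal σ, l.base.pred ∈ stratum rank α →
        (l.SatIn M' M ↔ l.SatIn N (saturate (stratum rank α) M)) := by
      intro l hl
      cases l with
      | pos p =>
        constructor
        · exact fun h J hJ => (agreeOn_glue _ J I₀ p hl).2 (h _ (hglue J hJ I₀ hI₀))
        · rintro h I ⟨⟨J, hJ, hJI⟩, -⟩
          exact (hJI p hl).1 (h J hJ)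
      | dneg p => exact (Literal.satIn_saturate (L := .dneg p) hl M M).symm
    have hM'M : M' ⊆ M := by
      refine hmax M' hMM' ⟨fun a ha I hI => ?_, fun r hr hb => ?_⟩
      · obtain ⟨β, hβ⟩ := hK.ont a ha
        by_cases h : β = α
        · subst h
          exact holds_of_mem_saturate hβ (hp.1 a ((hL.ont a).2 ⟨ha, hβ⟩)) hI.1
        · exact holds_of_mem_saturate hβ (hs.1 a ha) (hI.2 β h)
      -- A body true in `M'` is true in `M`. This settles heads of other ranks, above `α` as well,
      -- even though `M'` has fewer true atoms at rank `α`.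
      · have hbM : ∀ l ∈ r.body, l.SatIn M M := fun l hl => (hb l hl).anti hMM'
        by_cases h : rank r.head.base.pred = α
        · obtain ⟨r', hr', hhead, hbody⟩ :=
            hL.exists_reduced r hr h fun l hl _ => hbM l hl
          refine (hlit' _ h).2 (hhead ▸ hp.2 r' hr' fun l hl => ?_)
          rw [hbody] at hl
          exact (hlit' l hl.2).1 (hb l hl.1)
        · exact (hlit _ h).2 (hs.2 r hr hbM)
    exact fun J hJ => ⟨_, hM'M (hglue J hJ I₀ hI₀), (agreeOn_glue _ J I₀).symm⟩

end Splitting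

/-! ### One ontology-based knowledge base -/

section Basic

variable {σ : Signature.{u, v}} {D : DescriptionLogic.{u, v, w} σ}

theorem mem_predDiff {P : σ.Pred} {I J : Interp σ} {p : GroundAtom σ} :
    p ∈ predDiff P I J ↔ p.pred = P ∧ ¬ (p ∈ I ↔ p ∈ J) := by
  simp only [predDiff, restrictPred, Set.mem_union, Set.mem_sdiff, Set.mem_ofPred_eq]
  tauto

/-- Every `J ∈ N` is selected by the choice `I = J`, because nothing is closer to `J` than `J`
itself. -/
theorem update_univ (N : Set (Interp σ)) : update Set.univ N = N := by
  apply Set.Subset.antisymm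
  · intro J hJ
    simp only [update, Set.mem_iUnion] at hJ
    obtain ⟨I, -, hJ⟩ := hJ
    exact hJ.1
  · intro J hJ
    simp only [update, Set.mem_iUnion]
    refine ⟨J, Set.mem_univ J, hJ, ?_⟩
    rintro ⟨J', -, -, h⟩
    refine h fun P p hp => ?_
    exact ((mem_predDiff.1 hp).2 Iff.rfl).elim

theorem minimalChange_singleton (T : Set (Sentence σ)) : minimalChange [T] = modelSet T :=
  update_univ _

namespace HybridKB

theorem foTheory_isFirstOrder (K : HybridKB D) : ∀ φ ∈ K.foTheory, Formula.IsFirstOrder φ := by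
  rintro φ (⟨a, -, rfl⟩ | ⟨r, -, p, -, -, rfl⟩)
  · exact D.fo_isFirstOrder a
  · trivial

/-- Positive facts contain no default literal, so `M` plays no role and the only maximal solution is
the greatest one. -/
theorem OntBased.pairSat_iff {K : HybridKB D} (hK : K.OntBased) (M' M : Set (Interp σ)) :
    K.PairSat M' M ↔ M' ⊆ modelSet K.foTheory := by
  have hgr := isGreatest_modelSet K.foTheory_isFirstOrder
  have hent : Entails M' K.foTheory ↔ M' ⊆ modelSet K.foTheory := by
    refine ⟨fun h => hgr.2 h, fun h φ hφ I hI => ?_⟩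
    exact ((K.foTheory_isFirstOrder φ hφ).sat_iff _ I _ _ _ _).1 (hgr.1 φ hφ I (h hI))
  rw [← hent]
  constructor
  · rintro ⟨h₁, h₂⟩ φ (⟨a, ha, rfl⟩ | ⟨r, hr, p, hp, hf, rfl⟩) I hI
    · exact ((D.fo_isFirstOrder a).sat_iff _ I _ _ _ _).1 (h₁ a ha I hI)
    · have h := h₂ r hr fun L hL => by
        have hL' : L ∈ r.bodyList := hL
        rw [show r.bodyList = [] from hf] at hL'
        simp at hL'
      rw [hp] at h
      exact h I hI
  · intro h
    refine ⟨fun a ha I hI => ?_, fun r hr _ => ?_⟩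
    · exact ((D.fo_isFirstOrder a).sat_iff _ I _ _ _ _).1 (h _ (Or.inl ⟨a, ha, rfl⟩) I hI)
    · obtain ⟨⟨p, hp⟩, hf⟩ := hK r hr
      rw [hp]
      exact fun J hJ => h _ (Or.inr ⟨r, hr, p, hp, hf, rfl⟩) J hJ

theorem OntBased.isModel_iff {K : HybridKB D} (hK : K.OntBased) (M : Set (Interp σ)) :
    K.IsModel M ↔ M.Nonempty ∧ M = minimalChange [K.foTheory] := by
  rw [K.isModel_iff, minimalChange_singleton]
  simp only [hK.pairSat_iff]
  refine and_congr_right fun _ => ⟨?_, ?_⟩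
  · exact fun h => h.1.antisymm (h.2 _ h.1 subset_rfl)
  · rintro rfl
    exact ⟨subset_rfl, fun _ _ h => h⟩

end HybridKB

end Basic

/-! ### One program: MKNF, stable and dynamic stable models -/

section StableModels

variable {σ : Signature.{u, v}} {D : DescriptionLogic.{u, v, w} σ}

/-- Truth of a literal when atoms are evaluated in `J` and default literals in `I`. -/
def Literal.TrueInPair (J I : Interp σ) : Literal σ → Prop
  | .pos p => p ∈ J
  | .dneg p => p ∉ I

theorem Literal.satIn_iff_trueInPair (L : Literal σ) (M' M : Set (Interp σ)) :
    L.SatIn M' M ↔ L.TrueInPair (⋂₀ M') (⋂₀ M) := by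
  cases L with
  | pos p => exact Iff.rfl
  | dneg p => simp [Literal.SatIn, Literal.TrueInPair]

theorem Literal.trueInPair_self (L : Literal σ) (I : Interp σ) :
    L.TrueInPair I I ↔ L.TrueIn I := by
  cases L <;> exact Iff.rfl

theorem Literal.TrueInPair.trueIn {L : Literal σ} {J I : Interp σ} (h : L.TrueInPair J I)
    (hJ : J ⊆ I) : L.TrueIn I := by
  cases L with
  | pos p => exact hJ h
  | dneg p => exact h

theorem Literal.trueIn_compl (L : Literal σ) (I : Interp σ) :
    L.compl.TrueIn I ↔ ¬ L.TrueIn I := by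
  cases L with
  | pos p => exact Iff.rfl
  | dneg p => exact not_not.symm

theorem Literal.compl_compl (L : Literal σ) : L.compl.compl = L := by
  cases L <;> rfl

/-- `J` is a model of the reduct of `P` relative to `I`, where rules with default literals in the
head act as constraints. -/
def PairClosed (P : Program σ) (J I : Interp σ) : Prop :=
  ∀ r ∈ P, (∀ L ∈ r.body, L.TrueInPair J I) → r.head.TrueInPair J I

/-- `I` is a stable model of the single generalised program `P`. -/
def IsStable (P : Program σ) (I : Interp σ) : Prop :=
  PairClosed P I I ∧ ∀ J ⊆ I, PairClosed P J I → I ⊆ J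

theorem sInter_supersets (I : Interp σ) : ⋂₀ {J : Interp σ | I ⊆ J} = I :=
  Set.Subset.antisymm (Set.sInter_subset_of_mem (Set.Subset.refl I))
    (Set.subset_sInter fun _ h => h)

/-- Literals see a set of interpretations only through its intersection. A maximal `M` is therefore
the full upset of `⋂₀ M`, and enlarging `M` amounts to shrinking that intersection, so maximality
turns into minimality. -/
theorem HybridKB.ProgBased.isModel_iff_isStable {K : HybridKB D} (hK : K.ProgBased)
    (M : Set (Interp σ)) : K.IsModel M ↔ ∃ I, IsStable K.prog I ∧ M = {J | I ⊆ J} := by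
  have hpair : ∀ M' M, K.PairSat M' M ↔ PairClosed K.prog (⋂₀ M') (⋂₀ M) := by
    intro M' M
    have hont : K.ont = ∅ := hK
    simp [HybridKB.PairSat, PairClosed, hont, Literal.satIn_iff_trueInPair]
  rw [K.isModel_iff]
  simp only [hpair]
  constructor
  · rintro ⟨-, hs, hmax⟩
    have hsub : M ⊆ {J | ⋂₀ M ⊆ J} := fun J hJ => Set.sInter_subset_of_mem hJ
    have heq : M = {J | ⋂₀ M ⊆ J} :=
      hsub.antisymm (hmax _ hsub (by rwa [sInter_supersets]))
    refine ⟨⋂₀ M, ⟨hs, fun J hJ hc => ?_⟩, heq⟩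
    have h : {J' | J ⊆ J'} ⊆ M :=
      hmax _ (fun J' hJ' => hJ.trans (hsub hJ')) (by rwa [sInter_supersets])
    exact hsub (h (Set.Subset.refl J))
  · rintro ⟨I, ⟨hs, hmin⟩, rfl⟩
    rw [sInter_supersets]
    refine ⟨⟨I, Set.Subset.refl I⟩, hs, fun M' hM' hc J hJ => ?_⟩
    exact (hmin _ (Set.sInter_subset_of_mem (hM' (Set.Subset.refl I))) hc).trans
      (Set.sInter_subset_of_mem hJ)

theorem mem_survivingRules_singleton {P : Program σ} {I : Interp σ} {r : Rule σ} :
    r ∈ survivingRules [P] I ↔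
      r ∈ P ∧ ¬ ∃ r' ∈ P, r.Conflicts r' ∧ SatBody I r'.body := by
  constructor
  · rintro ⟨i, hr, hn⟩
    obtain rfl : i = (0 : Fin 1) := Subsingleton.elim (α := Fin 1) _ _
    exact ⟨hr, fun ⟨r', h⟩ => hn ⟨(0 : Fin 1), le_rfl, r', h⟩⟩
  · rintro ⟨hr, hn⟩
    refine ⟨(0 : Fin 1), hr, ?_⟩
    rintro ⟨j, -, r', h⟩
    obtain rfl : j = (0 : Fin 1) := Subsingleton.elim (α := Fin 1) _ _
    exact hn ⟨r', h⟩

theorem mem_defaultFacts_singleton {P : Program σ} {I : Interp σ} {r : Rule σ} :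
    r ∈ defaultFacts [P] I ↔
      r.IsFact ∧ ∃ p, r.head = .dneg p ∧
        ¬ ∃ r' ∈ P, r'.head = .pos p ∧ SatBody I r'.body := by
  refine and_congr_right fun _ => exists_congr fun p => and_congr_right fun _ => not_congr ?_
  constructor
  · rintro ⟨i, r', h⟩
    obtain rfl : i = (0 : Fin 1) := Subsingleton.elim (α := Fin 1) _ _
    exact ⟨r', h⟩
  · rintro ⟨r', h⟩
    exact ⟨(0 : Fin 1), r', h⟩

theorem leastModel_subset {P : Program σ} {S : Set (Literal σ)}
    (h : ∀ r ∈ P, r.body ⊆ S → r.head ∈ S) : leastModel P ⊆ S :=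
  Set.sInter_subset_of_mem h

theorem head_mem_leastModel {P : Program σ} {r : Rule σ} (hr : r ∈ P)
    (h : r.body ⊆ leastModel P) : r.head ∈ leastModel P :=
  Set.mem_sInter.2 fun _ hS => hS r hr (h.trans (Set.sInter_subset_of_mem hS))

theorem Rule.IsFact.body_eq {r : Rule σ} (h : r.IsFact) : r.body = ∅ := by
  have h' : r.bodyList = [] := h
  ext L
  simp [Rule.body, h']

/-- The members of the least model are heads of rules whose bodies hold in it. -/
theorem exists_rule_of_mem_leastModel {P : Program σ} {L : Literal σ} (hL : L ∈ leastModel P) :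
    ∃ r ∈ P, r.head = L ∧ r.body ⊆ leastModel P := by
  by_contra! hn
  -- Without a supporting rule, `L` could be deleted and the set would stay closed.
  have hsub : leastModel P ⊆ leastModel P \ {L} := by
    refine leastModel_subset fun r hr hb => ?_
    have hb' := hb.trans Set.sdiff_subset
    exact ⟨head_mem_leastModel hr hb', fun h => hn r hr h hb'⟩
  exact (hsub hL).2 rfl

/-- A stable `I` is a model of `P`, and two conflicting rules with true bodies would have
complementary true heads. So every rule with a true body survives, and rejection only removes rules
that derive nothing. -/
theorem IsStable.isDynamicStableModel {P : Program σ} {I : Interp σ} (h : IsStable P I) :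
    IsDynamicStableModel [P] I := by
  obtain ⟨hc, hmin⟩ := h
  have hmodel : ∀ r ∈ P, SatBody I r.body → r.head.TrueIn I := fun r hr hb =>
    (Literal.trueInPair_self _ _).1
      (hc r hr fun L hL => (Literal.trueInPair_self _ _).2 (hb L hL))
  have hsurv : ∀ r ∈ P, SatBody I r.body → r ∈ survivingRules [P] I := by
    refine fun r hr hb => mem_survivingRules_singleton.2 ⟨hr, ?_⟩
    rintro ⟨r', hr', hconf, hb'⟩
    have h₁ := hmodel r hr hb
    rw [show r.head = r'.head.compl from hconf, Literal.trueIn_compl] at h₁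
    exact h₁ (hmodel r' hr' hb')
  unfold IsDynamicStableModel
  set Q := survivingRules [P] I ∪ defaultFacts [P] I with hQ
  -- Atoms of `I` that are derivable, given the default literals that are true in `I`.
  have hderiv : (∀ p, p ∉ I → Literal.dneg p ∈ leastModel Q) →
      I ⊆ {p | p ∈ I ∧ Literal.pos p ∈ leastModel Q} := by
    intro hneg
    refine hmin _ (fun p hp => hp.1) fun r hr hb => ?_
    have hbI : SatBody I r.body := fun L hL => (hb L hL).trueIn fun p hp => hp.1
    have hhead := hmodel r hr hbI
    have hmem : r.head ∈ leastModel Q := by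
      refine head_mem_leastModel (Or.inl (hsurv r hr hbI)) fun L hL => ?_
      have hL' := hb L hL
      cases L with
      | pos p => exact hL'.2
      | dneg p => exact hneg p hL'
    cases hh : r.head with
    | pos p => rw [hh] at hhead hmem; exact ⟨hhead, hmem⟩
    | dneg p => rw [hh] at hhead; exact hhead
  have hneg : ∀ p, p ∉ I → Literal.dneg p ∈ leastModel Q := by
    intro p hp
    refine head_mem_leastModel (r := ⟨.dneg p, []⟩) (Or.inr ?_)
      (fun L hL => (List.not_mem_nil hL).elim)
    refine mem_defaultFacts_singleton.2 ⟨rfl, p, rfl, ?_⟩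
    rintro ⟨r', hr', hh, hb⟩
    have := hmodel r' hr' hb
    rw [hh] at this
    exact hp this
  apply Set.Subset.antisymm
  · intro L hL
    cases L with
    | pos p => exact (hderiv hneg hL).2
    | dneg p => exact hneg p hL
  · refine leastModel_subset ?_
    rintro r (hr | hr) hb
    · exact hmodel r (mem_survivingRules_singleton.1 hr).1 hb
    · obtain ⟨-, p, hh, hn⟩ := mem_defaultFacts_singleton.1 hr
      rw [hh]
      intro hp
      -- A default fact for some `p ∈ I` would mean that `p` has no support, and then `I \ {p}`
      -- would contradict minimality.
      have hsub : I ⊆ I \ {p} := by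
        refine hmin _ Set.sdiff_subset fun r' hr' hb' => ?_
        have hbI : SatBody I r'.body := fun L hL => (hb' L hL).trueIn Set.sdiff_subset
        have hhead := hmodel r' hr' hbI
        cases hh' : r'.head with
        | pos q =>
          rw [hh'] at hhead
          refine ⟨hhead, fun hq => hn ⟨r', hr', ?_, hbI⟩⟩
          rw [hh', show q = p from hq]
        | dneg q => rw [hh'] at hhead; exact hhead
      exact (hsub hp).2 rfl

/-- Rejection inside a single program is mutual. If two conflicting rules had true bodies, every
rule for either head would be rejected and the default fact blocked, yet one of the two
complementary heads is true in `I` and needs support. So `I` is a model of `P`. -/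
theorem IsDynamicStableModel.isStable {P : Program σ} {I : Interp σ}
    (h : IsDynamicStableModel [P] I) : IsStable P I := by
  unfold IsDynamicStableModel at h
  have hmem : ∀ L : Literal σ, L.TrueIn I ↔
      L ∈ leastModel (survivingRules [P] I ∪ defaultFacts [P] I) := fun L => by
    rw [← h]; exact Iff.rfl
  have hmodel : ∀ r ∈ P, SatBody I r.body → r.head.TrueIn I := by
    intro r hr hb
    by_cases hrej : ∃ r' ∈ P, r.Conflicts r' ∧ SatBody I r'.body
    · obtain ⟨r', hr', hconf, hb'⟩ := hrej
      have hconf : r.head = r'.head.compl := hconf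
      -- Neither of the two conflicting heads can be derived.
      have hnot : ∀ L : Literal σ, L = r.head ∨ L = r'.head → ¬ L.TrueIn I := by
        intro L hL hT
        obtain ⟨s, hs, hsL, -⟩ := exists_rule_of_mem_leastModel ((hmem L).1 hT)
        rcases hs with hs | hs
        · refine (mem_survivingRules_singleton.1 hs).2 ?_
          rcases hL with rfl | rfl
          · exact ⟨r', hr', hsL.trans hconf, hb'⟩
          · refine ⟨r, hr, ?_, hb⟩
            change s.head = r.head.compl
            rw [hsL, hconf, Literal.compl_compl]
        · obtain ⟨-, p, hp, hn⟩ := mem_defaultFacts_singleton.1 hs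
          rw [hsL] at hp
          rcases hL with rfl | rfl
          · refine hn ⟨r', hr', ?_, hb'⟩
            rw [← Literal.compl_compl r'.head, ← hconf, hp]
            rfl
          · refine hn ⟨r, hr, ?_, hb⟩
            rw [hconf, hp]
            rfl
      have h₁ := hnot _ (Or.inl rfl)
      rw [hconf, Literal.trueIn_compl] at h₁
      exact (h₁ (hnot _ (Or.inr rfl))).elim
    · refine (hmem _).2 (head_mem_leastModel
        (Or.inl (mem_survivingRules_singleton.2 ⟨hr, hrej⟩)) fun L hL => (hmem L).1 (hb L hL))
  refine ⟨fun r hr hb => (Literal.trueInPair_self _ _).2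
    (hmodel r hr fun L hL => (Literal.trueInPair_self _ _).1 (hb L hL)), fun J hJ hc => ?_⟩
  -- Minimality: a closed `J`, together with the default literals true in `I`, is closed under the
  -- rules that generate `I`.
  have hsub : leastModel (survivingRules [P] I ∪ defaultFacts [P] I) ⊆
      {L | L.TrueInPair J I} := by
    refine leastModel_subset ?_
    rintro r (hr | hr) hb
    · exact hc r (mem_survivingRules_singleton.1 hr).1 hb
    · obtain ⟨hf, p, hp, -⟩ := mem_defaultFacts_singleton.1 hr
      have hT : r.head.TrueIn I := (hmem _).2 (head_mem_leastModel (Or.inr hr)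
        (by rw [hf.body_eq]; exact Set.empty_subset _))
      rw [hp] at hT ⊢
      exact hT
  exact fun p hp => hsub ((hmem (.pos p)).1 hp)

theorem HybridKB.ProgBased.isModel_iff {K : HybridKB D} (hK : K.ProgBased)
    (M : Set (Interp σ)) :
    K.IsModel M ↔ ∃ I, IsDynamicStableModel [K.prog] I ∧ M = {J | I ⊆ J} := by
  rw [hK.isModel_iff_isStable]
  exact exists_congr fun I => and_congr_left' ⟨fun h => h.isDynamicStableModel, fun h => h.isStable⟩

theorem DynamicKB.isBasicDynamicModel_singleton_iff {K : HybridKB D}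
    (hK : K.OntBased ∨ K.ProgBased) (M : Set (Interp σ)) :
    DynamicKB.IsBasicDynamicModel [K] M ↔ K.IsModel M := by
  constructor
  · rintro ⟨hne, ⟨hb, hM⟩ | ⟨hb, hM⟩⟩
    · exact (HybridKB.OntBased.isModel_iff (hb K (by simp)) M).2 ⟨hne, hM⟩
    · exact (HybridKB.ProgBased.isModel_iff (hb K (by simp)) M).2 hM
  · intro h
    refine ⟨h.1.1, hK.imp (fun hb => ?_) fun hb => ?_⟩
    · exact ⟨by simpa [DynamicKB.OntBased] using hb, (hb.isModel_iff M).1 h |>.2⟩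
    · exact ⟨by simpa [DynamicKB.ProgBased] using hb, (hb.isModel_iff M).1 h⟩

end StableModels

/-! ### From splitting sequences to ranks and layers -/

section Layers

variable {σ : Signature.{u, v}} {D : DescriptionLogic.{u, v, w} σ}

/-- `rank P` is the least index below `μ` of a member of the sequence that contains `P`. -/
structure IsRank (μ : Ordinal.{u}) (U : Ordinal.{u} → Set σ.Pred) (rank : σ.Pred → Ordinal.{u}) :
    Prop where
  lt : ∀ P, rank P < μ
  mem_iff : ∀ P, ∀ β < μ, P ∈ U β ↔ rank P ≤ β

theorem litPreds_subset_iff {B : Set (Literal σ)} {U : Set σ.Pred} :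
    litPreds B ⊆ U ↔ ∀ L ∈ B, L.base.pred ∈ U := by
  simp [litPreds, Literal.preds]

theorem Rule.preds_subset_iff {r : Rule σ} {U : Set σ.Pred} :
    r.preds ⊆ U ↔ r.head.base.pred ∈ U ∧ ∀ L ∈ r.body, L.base.pred ∈ U := by
  rw [Rule.preds, Set.union_subset_iff, litPreds_subset_iff, Literal.preds,
    Set.singleton_subset_iff]

theorem entails_literals_iff {X : Set (Interp σ)} (hX : X.Nonempty) (S : Set (Literal σ)) :
    Entails X (Literal.trans '' S) ↔ ∀ L ∈ S, L.SatIn X X := by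
  obtain ⟨I, hI⟩ := hX
  constructor
  · exact fun h L hL => (L.holds_trans I X X).1 (h _ ⟨L, hL, rfl⟩ I hI)
  · rintro h _ ⟨L, hL, rfl⟩ J _
    exact (L.holds_trans J X X).2 (h L hL)

namespace HybridKB

theorem isModel_empty_iff (M : Set (Interp σ)) :
    (⟨∅, ∅⟩ : HybridKB D).IsModel M ↔ M = Set.univ := by
  rw [isModel_iff]
  have hp : ∀ M' M : Set (Interp σ), (⟨∅, ∅⟩ : HybridKB D).PairSat M' M := fun _ _ =>
    ⟨fun _ h => h.elim, fun _ h => h.elim⟩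
  constructor
  · exact fun h => Set.univ_subset_iff.1 (h.2.2 _ (Set.subset_univ M) (hp _ _))
  · rintro rfl
    exact ⟨⟨∅, trivial⟩, hp _ _, fun _ _ _ => Set.subset_univ _⟩

theorem IsSplittingSequence.exists_isRank {K : HybridKB D} {μ : Ordinal.{u}}
    {U : Ordinal.{u} → Set σ.Pred} (h : K.IsSplittingSequence μ U) :
    ∃ rank, IsRank μ U rank := by
  have hex : ∀ P : σ.Pred, ∃ α, α < μ ∧ P ∈ U α := fun P => by
    have hP : P ∈ ⋃ α < μ, U α := by rw [h.exhaustive]; trivial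
    simpa using hP
  have hmin : ∀ P : σ.Pred, ∃ α, (α < μ ∧ P ∈ U α) ∧ ∀ β, β < μ ∧ P ∈ U β → α ≤ β := fun P =>
    ⟨sInf {α | α < μ ∧ P ∈ U α}, csInf_mem (s := {α | α < μ ∧ P ∈ U α}) (hex P),
      fun β hβ => csInf_le' hβ⟩
  choose rank hrank hle using hmin
  exact ⟨rank, fun P => (hrank P).1, fun P β hβ =>
    ⟨fun hP => hle P β ⟨hβ, hP⟩, fun hP => h.monotone _ _ hP hβ (hrank P).2⟩⟩

variable {K : HybridKB D} {μ : Ordinal.{u}} {U : Ordinal.{u} → Set σ.Pred}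
  {rank : σ.Pred → Ordinal.{u}}

/-- `U (rank P)` is a splitting set containing `P`, so it contains every axiom in which `P` occurs
and every rule with `P` in the head. Applied to two symbols of one axiom, this bounds each rank by
the other. -/
theorem IsSplittingSequence.isStratified (h : K.IsSplittingSequence μ U)
    (hr : IsRank μ U rank) : K.IsStratified rank := by
  have hself : ∀ P, P ∈ U (rank P) := fun P => (hr.mem_iff P _ (hr.lt P)).2 le_rfl
  refine ⟨fun a ha => ?_, fun r hrK L hL => ?_⟩
  · have hle : ∀ P ∈ D.preds a, ∀ Q ∈ D.preds a, rank Q ≤ rank P := fun P hP Q hQ =>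
      (hr.mem_iff Q _ (hr.lt P)).1 ((h.splitting _ (hr.lt P)).1 a ha ⟨P, hP, hself P⟩ hQ)
    obtain ⟨P, hP⟩ := (D.fo a).preds_nonempty
    exact ⟨rank P, fun Q hQ => le_antisymm (hle P hP Q hQ) (hle Q hQ P hP)⟩
  · have hsub := (h.splitting _ (hr.lt _)).2 r hrK ⟨_, rfl, hself r.head.base.pred⟩
    exact (hr.mem_iff _ _ (hr.lt _)).1 ((Rule.preds_subset_iff.1 hsub).2 L hL)

theorem IsSplittingSequence.rank_ne_of_isSuccLimit (h : K.IsSplittingSequence μ U)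
    (hr : IsRank μ U rank) {α : Ordinal.{u}} (hα : Order.IsSuccLimit α) (P : σ.Pred) :
    rank P ≠ α := by
  rintro rfl
  have hP := (hr.mem_iff P _ (hr.lt P)).2 le_rfl
  rw [h.continuous _ (hr.lt P) hα] at hP
  simp only [Set.mem_iUnion] at hP
  obtain ⟨β, hβ, hPβ⟩ := hP
  exact ((hr.mem_iff P β (hβ.trans (hr.lt P))).1 hPβ).not_gt hβ

theorem isLayer_empty {α : Ordinal.{u}} (h : ∀ P, rank P ≠ α)
    (M : Set (Interp σ)) : K.IsLayer rank M α ⟨∅, ∅⟩ where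
  ont a := by
    refine ⟨fun ha => ha.elim, fun ha => ?_⟩
    obtain ⟨P, hP⟩ := (D.fo a).preds_nonempty
    exact (h P (ha.2 hP)).elim
  exists_rule _ hr := hr.elim
  exists_reduced _ _ hα := (h _ hα).elim

/-- Needed because a solution evaluates the reduct in the intersection of the earlier `X η`, whereas
the splitting lemmas evaluate it in the whole of `M`. -/
theorem IsLayer.congr {L : HybridKB D} {M₁ M₂ : Set (Interp σ)} {α : Ordinal.{u}}
    (h : K.IsLayer rank M₁ α L)
    (hM : ∀ l : Literal σ, rank l.base.pred < α → (l.SatIn M₁ M₁ ↔ l.SatIn M₂ M₂)) :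
    K.IsLayer rank M₂ α L where
  ont := h.ont
  exists_rule r' hr' := by
    obtain ⟨r, hr, hhead, hα, hlow, hbody⟩ := h.exists_rule r' hr'
    exact ⟨r, hr, hhead, hα, fun l hl hlt => (hM l hlt).1 (hlow l hl hlt), hbody⟩
  exists_reduced r hr hα hlow :=
    h.exists_reduced r hr hα fun l hl hlt => (hM l hlt).2 (hlow l hl hlt)

theorem IsSplittingSequence.isLayer_bottom (h : K.IsSplittingSequence μ U)
    (hr : IsRank μ U rank) (M : Set (Interp σ)) : K.IsLayer rank M 0 (K.bottom (U 0)) := by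
  have hU : U 0 = stratum rank 0 := by
    ext P
    rw [hr.mem_iff P 0 h.pos, nonpos_iff_eq_zero]
    rfl
  have hbody : ∀ r : Rule σ, r.preds ⊆ U 0 →
      r.body = {l ∈ r.body | l.base.pred ∈ stratum rank 0} := fun r hs => by
    rw [hU, Rule.preds_subset_iff] at hs
    exact (Set.sep_eq_self_iff_mem_true.2 hs.2).symm
  refine ⟨fun a => by rw [← hU]; rfl, fun r hrb => ?_, fun r hrK h0 _ => ?_⟩
  · have h0 : r.head.base.pred ∈ stratum rank 0 := hU ▸ (Rule.preds_subset_iff.1 hrb.2).1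
    exact ⟨r, hrb.1, rfl, h0, fun l _ hlt => (not_lt_zero hlt).elim, hbody r hrb.2⟩
  · have hs : r.preds ⊆ U 0 := by
      rw [hU]
      refine Rule.preds_subset_iff.2 ⟨h0, fun l hl => ?_⟩
      exact nonpos_iff_eq_zero.1 (((h.isStratified hr).prog r hrK l hl).trans_eq h0)
    exact ⟨r, ⟨hrK, hs⟩, rfl, hbody r hs⟩

/-- The symbols in `U α` are those of rank below `α + 1`. As bodies never outrank heads, a rule of
`K` lies in the top of the bottom exactly if its head has rank `α + 1`. -/
theorem IsSplittingSequence.isLayer_reduct (h : K.IsSplittingSequence μ U)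
    (hr : IsRank μ U rank) {α : Ordinal.{u}} (hα : α + 1 < μ) {Y : Set (Interp σ)}
    (hY : Y.Nonempty) :
    K.IsLayer rank Y (α + 1) ((K.bottom (U (α + 1))).reduct (U α) Y) := by
  have hst := h.isStratified hr
  have hα' : α < μ := (lt_add_one α).trans hα
  have hmem : ∀ P, P ∈ U α ↔ rank P < α + 1 := fun P =>
    (hr.mem_iff P α hα').trans Order.lt_add_one_iff.symm
  have hmem' : ∀ P, P ∈ U (α + 1) ↔ rank P ≤ α + 1 := fun P => hr.mem_iff P _ hα
  have hlow : ∀ r : Rule σ, Entails Y (Literal.trans '' {L ∈ r.body | L.preds ⊆ U α}) ↔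
      ∀ l ∈ r.body, rank l.base.pred < α + 1 → l.SatIn Y Y := fun r => by
    rw [entails_literals_iff hY]
    simp only [Literal.preds, Set.singleton_subset_iff, hmem, Set.mem_ofPred_eq, and_imp]
  have hbody : ∀ r : Rule σ, r.preds ⊆ U (α + 1) → {L ∈ r.body | L.preds ⊆ (U α)ᶜ} =
      {l ∈ r.body | l.base.pred ∈ stratum rank (α + 1)} := fun r hs => by
    ext l
    refine and_congr_right fun hl => ?_
    have hle := (hmem' _).1 ((Rule.preds_subset_iff.1 hs).2 l hl)
    simp only [Literal.preds, Set.singleton_subset_iff, Set.mem_compl_iff, hmem, not_lt]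
    exact ⟨fun h => hle.antisymm h, fun h => Eq.ge h⟩
  have htop : ∀ r ∈ K.prog, r ∈ ((K.bottom (U (α + 1))).top (U α)).prog ↔
      rank r.head.base.pred = α + 1 := by
    intro r hrK
    constructor
    · rintro ⟨⟨-, hs⟩, hn⟩
      refine ((hmem' _).1 (Rule.preds_subset_iff.1 hs).1).antisymm (not_lt.1 fun hlt => hn ?_)
      exact ⟨⟨hrK, hs⟩, Rule.preds_subset_iff.2 ⟨(hmem _).2 hlt, fun l hl =>
        (hmem _).2 ((hst.prog r hrK l hl).trans_lt hlt)⟩⟩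
    · intro heq
      refine ⟨⟨hrK, Rule.preds_subset_iff.2 ⟨(hmem' _).2 heq.le, fun l hl =>
        (hmem' _).2 ((hst.prog r hrK l hl).trans_eq heq)⟩⟩, ?_⟩
      rintro ⟨-, hs⟩
      exact ((hmem _).1 (Rule.preds_subset_iff.1 hs).1).ne heq
  refine ⟨fun a => ?_, ?_, fun r hrK hα hl => ?_⟩
  · constructor
    · rintro ⟨⟨ha, hs⟩, hn⟩
      refine ⟨ha, ?_⟩
      obtain ⟨β, hβ⟩ := hst.ont a ha
      obtain ⟨P, hP⟩ := (D.fo a).preds_nonempty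
      have hle : β ≤ α + 1 := (Eq.symm (hβ hP)).trans_le ((hmem' P).1 (hs hP))
      have hge : α + 1 ≤ β := not_lt.1 fun hlt =>
        hn ⟨⟨ha, hs⟩, fun Q hQ => (hmem Q).2 ((hβ hQ : rank Q = β).trans_lt hlt)⟩
      exact hle.antisymm hge ▸ hβ
    · rintro ⟨ha, hs⟩
      refine ⟨⟨ha, fun P hP => (hmem' P).2 (Eq.le (hs hP))⟩, ?_⟩
      rintro ⟨-, hs'⟩
      obtain ⟨P, hP⟩ := (D.fo a).preds_nonempty
      exact ((hmem P).1 (hs' hP)).ne (hs hP)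
  · rintro r' ⟨r, hrt, hent, hhead, hb⟩
    exact ⟨r, hrt.1.1, hhead, (htop r hrt.1.1).1 hrt, (hlow r).1 hent,
      hb.trans (hbody r hrt.1.2)⟩
  · classical
    have hrt := (htop r hrK).2 hα
    -- The reduct prescribes bodies only as sets. Filtering the list gives one rule with the
    -- required body.
    have hb : (⟨r.head, r.bodyList.filter fun l => l.base.pred ∈ stratum rank (α + 1)⟩ :
        Rule σ).body = {l ∈ r.body | l.base.pred ∈ stratum rank (α + 1)} := by
      ext l
      simp [Rule.body]
    exact ⟨⟨r.head, r.bodyList.filter fun l => l.base.pred ∈ stratum rank (α + 1)⟩,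
      ⟨r, hrt, (hlow r).2 hl, rfl, hb.trans (hbody r hrt.1.2).symm⟩, rfl, hb⟩

theorem Reducible.ontBased_or_progBased (h : K.Reducible ∅) : K.OntBased ∨ K.ProgBased := by
  refine h.imp_left fun h r hr => ⟨(h r hr).1, ?_⟩
  have hs := litPreds_subset_iff.1 (h r hr).2
  exact List.eq_nil_iff_forall_not_mem.2 fun L hL => hs L hL

/-- In the first alternative all body literals lie in `V`, so the reduct deletes them and leaves
positive facts. -/
theorem Reducible.reduct_ontBased_or_progBased {V : Set σ.Pred} (h : (K.top V).Reducible V)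
    (X : Set (Interp σ)) : (K.reduct V X).OntBased ∨ (K.reduct V X).ProgBased := by
  refine h.imp_left fun h => ?_
  rintro r' ⟨r, hr, -, hhead, hb⟩
  obtain ⟨⟨p, hp⟩, hs⟩ := h r hr
  refine ⟨⟨p, hhead.trans hp⟩, List.eq_nil_iff_forall_not_mem.2 fun L hL => ?_⟩
  have hL' : L ∈ r'.body := hL
  rw [hb] at hL'
  exact hL'.2 rfl (litPreds_subset_iff.1 hs L hL'.1)

end HybridKB

namespace DynamicKB

variable {K : HybridKB D} {μ : Ordinal.{u}} {U : Ordinal.{u} → Set σ.Pred}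
  {rank : σ.Pred → Ordinal.{u}}

theorem isUpdateEnabling_singleton_iff : IsUpdateEnabling [K] μ U ↔ K.IsUpdateEnabling μ U := by
  constructor
  · rintro ⟨h₁, h₂, h₃⟩
    refine ⟨h₁ K (by simp), ?_, fun α hα => ?_⟩
    · simpa [Reducible, bottom, HybridKB.Reducible] using h₂
    · simpa [Reducible, bottom, top, HybridKB.Reducible] using h₃ α hα
  · rintro ⟨h₁, h₂, h₃⟩
    refine ⟨by simpa using h₁, ?_, fun α hα => ?_⟩
    · simpa [Reducible, bottom, HybridKB.Reducible] using h₂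
    · simpa [Reducible, bottom, top, HybridKB.Reducible] using h₃ α hα

/-- The condition on `X α` in the definition of a solution. -/
structure SolvesAt (K : DynamicKB D) (U : Ordinal.{u} → Set σ.Pred)
    (X : Ordinal.{u} → Set (Interp σ)) (α : Ordinal.{u}) : Prop where
  zero : α = 0 → IsBasicDynamicModel (bottom (U 0) K) (X α)
  succ : ∀ β, α = β + 1 →
    IsBasicDynamicModel (reduct (U β) (⋂ η ≤ β, X η) (bottom (U (β + 1)) K)) (X α)
  limit : Order.IsSuccLimit α → X α = Set.univ

theorem isSolution_iff {K : DynamicKB D} {X : Ordinal.{u} → Set (Interp σ)} (hμ : 0 < μ) :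
    IsSolution K μ U X ↔ ∀ α < μ, (X α).Nonempty ∧ SolvesAt K U X α := by
  constructor
  · refine fun h α hα => ⟨h.nonempty α hα, ?_, ?_, h.limit α hα⟩
    · rintro rfl
      exact h.zero
    · rintro β rfl
      exact h.succ β hα
  · exact fun h => ⟨fun α hα => (h α hα).1, (h 0 hμ).2.zero rfl,
      fun α hα => (h _ hα).2.succ α rfl, fun α hα => (h α hα).2.limit⟩

/-- Zero, successor and limit indices come under one condition: `X α` is a model of layer `α`. At
limits, continuity leaves no symbol of rank `α`, so the layer is empty. -/
theorem exists_isLayer_solvesAt_iff (hU : K.IsUpdateEnabling μ U) (hr : IsRank μ U rank)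
    {X : Ordinal.{u} → Set (Interp σ)} {α : Ordinal.{u}} (hα : α < μ)
    (hne : (⋂ η < α, X η).Nonempty) :
    ∃ L : HybridKB D, K.IsLayer rank (⋂ η < α, X η) α L ∧
      (SolvesAt [K] U X α ↔ L.IsModel (X α)) := by
  have hs := hU.isSplittingSequence
  rcases Ordinal.zero_or_succ_or_isSuccLimit α with rfl | ⟨β, rfl⟩ | hlim
  · refine ⟨_, hs.isLayer_bottom hr _, ?_⟩
    rw [← isBasicDynamicModel_singleton_iff hU.zero.ontBased_or_progBased]
    refine ⟨fun h => h.zero rfl, fun h => ⟨fun _ => h, fun β hβ => ?_, fun h0 => ?_⟩⟩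
    · exact (Order.succ_ne_bot β hβ.symm).elim
    · exact (h0.1 isMin_bot).elim
  · rw [Order.succ_eq_add_one] at hα hne ⊢
    have hY : ⋂ η < β + 1, X η = ⋂ η ≤ β, X η := by simp only [Order.lt_add_one_iff]
    rw [hY] at hne ⊢
    refine ⟨_, hs.isLayer_reduct hr hα hne, ?_⟩
    rw [← isBasicDynamicModel_singleton_iff
      ((hU.succ β hα).reduct_ontBased_or_progBased _)]
    refine ⟨fun h => h.succ β rfl, fun h => ⟨fun h0 => ?_, fun γ hγ => ?_, fun hl => ?_⟩⟩
    · exact (Order.succ_ne_bot β h0).elim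
    · obtain rfl : β = γ := Order.succ_injective hγ
      exact h
    · exact (Order.not_isSuccLimit_succ β hl).elim
  · refine ⟨_, HybridKB.isLayer_empty (hs.rank_ne_of_isSuccLimit hr hlim) _, ?_⟩
    rw [HybridKB.isModel_empty_iff]
    refine ⟨fun h => h.limit hlim, fun h => ⟨fun h0 => ?_, fun β hβ => ?_, fun _ => h⟩⟩
    · subst h0
      exact (hlim.1 isMin_bot).elim
    · subst hβ
      exact (Order.not_isSuccLimit_succ β hlim).elim

theorem IsDynamicModelWrt.isModel (hU : K.IsUpdateEnabling μ U) {M : Set (Interp σ)}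
    (h : IsDynamicModelWrt [K] μ U M) : K.IsModel M := by
  obtain ⟨hne, X, hX, rfl⟩ := h
  have hs := hU.isSplittingSequence
  obtain ⟨rank, hr⟩ := hs.exists_isRank
  rw [isSolution_iff hs.pos] at hX
  have hsub : ∀ α < μ, ⋂ η < μ, X η ⊆ ⋂ η < α, X η := fun α hα =>
    Set.biInter_mono (fun η hη => lt_trans hη hα) fun _ _ => subset_rfl
  -- The splitting lemma takes a family over all ordinals. From `μ` on the layer is empty, and `⋂ (_
  -- : α < μ), X α` is `Set.univ`, as it should be.
  have hlayer : ∀ α, ∃ (Y : Set (Interp σ)) (L : HybridKB D), ⋂ η < μ, X η ⊆ Y ∧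
      (∀ η < α, η < μ → Y ⊆ X η) ∧ K.IsLayer rank Y α L ∧ L.IsModel (⋂ (_ : α < μ), X α) := by
    intro α
    by_cases hα : α < μ
    · obtain ⟨L, hL, hiff⟩ := exists_isLayer_solvesAt_iff hU hr hα (hne.mono (hsub α hα))
      refine ⟨_, L, hsub α hα, fun η hη _ => Set.biInter_subset_of_mem hη, hL, ?_⟩
      simpa [hα] using hiff.1 (hX α hα).2
    · refine ⟨_, _, subset_rfl, fun η _ hη => Set.biInter_subset_of_mem hη,
        HybridKB.isLayer_empty (rank := rank) (α := α) (fun P h => hα (h ▸ hr.lt P)) _, ?_⟩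
      simp [HybridKB.isModel_empty_iff, hα]
  choose Y L hMY hY hL hmod using hlayer
  have hsat := saturate_stratum_iInter
    (fun α => (hmod α).saturate_subset (hL α).predsIn) hne
  refine HybridKB.isModel_iInter_of_isLayer (hs.isStratified hr) hne
    (fun α => (hL α).congr fun l hl => ?_) hmod
  -- The saturation is the component at the rank of `l`, which is below `α` and hence among those
  -- already met in `Y α`.
  have hYs : Y α ⊆ saturate (stratum rank (rank l.base.pred)) (⋂ η < μ, X η) := by
    rw [hsat]
    exact Set.subset_iInter fun hη => hY α _ hl hη
  exact Literal.satIn_of_between (V := stratum rank (rank l.base.pred)) rfl (hMY α) hYs (hMY α) hYs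

theorem _root_.HybridMKNF.HybridKB.IsModel.isDynamicModelWrt (hU : K.IsUpdateEnabling μ U)
    {M : Set (Interp σ)} (hM : K.IsModel M) : IsDynamicModelWrt [K] μ U M := by
  have hne : M.Nonempty := hM.1.1
  have hs := hU.isSplittingSequence
  obtain ⟨rank, hr⟩ := hs.exists_isRank
  have hst := hs.isStratified hr
  set X : Ordinal.{u} → Set (Interp σ) := fun α => saturate (stratum rank α) M with hXdef
  have hMX : ∀ α, M ⊆ X α := fun α => subset_saturate _ M
  refine ⟨hne, X, (isSolution_iff hs.pos).2 fun α hα => ⟨hne.mono (hMX α), ?_⟩, ?_⟩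
  · have hMY : M ⊆ ⋂ η < α, X η := Set.subset_iInter₂ fun η _ => hMX η
    obtain ⟨L, hL, hiff⟩ := exists_isLayer_solvesAt_iff hU hr hα (hne.mono hMY)
    refine hiff.2 (hM.isModel_saturate hst (hL.congr fun l hl => ?_))
    have hYs : ⋂ η < α, X η ⊆ saturate (stratum rank (rank l.base.pred)) M :=
      Set.biInter_subset_of_mem (t := X) hl
    exact Literal.satIn_of_between (V := stratum rank (rank l.base.pred)) rfl hMY hYs hMY hYs
  · apply Set.Subset.antisymm (Set.subset_iInter₂ fun η _ => hMX η)
    conv_rhs => rw [hM.eq_iInter_saturate hst]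
    intro J hJ
    refine Set.mem_iInter.2 fun α => ?_
    by_cases hα : α < μ
    · exact Set.mem_iInter₂.1 hJ α hα
    · obtain ⟨I, hI⟩ := hne
      -- No symbol has rank `α ≥ μ`, so agreement on that stratum is vacuous.
      exact ⟨I, hI, fun p hp => (hα ((hp : rank p.pred = α) ▸ hr.lt p.pred)).elim⟩

end DynamicKB

end Layers

end HybridMKNF

theorem mainTheorem4 {σ : HybridMKNF.Signature.{u, v}}
    {D : HybridMKNF.DescriptionLogic.{u, v, w} σ} (K : HybridMKNF.HybridKB D) (hK : K.Updatable)
    (M : Set (HybridMKNF.Interp σ)) (hM : M.Nonempty) :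
    HybridMKNF.DynamicKB.IsDynamicModel [K] M ↔ K.IsModel M := by
  constructor
  · rintro ⟨μ, U, hU, h⟩
    exact h.isModel (HybridMKNF.DynamicKB.isUpdateEnabling_singleton_iff.1 hU)
  · intro h
    obtain ⟨μ, U, hU⟩ := hK
    exact ⟨μ, U, HybridMKNF.DynamicKB.isUpdateEnabling_singleton_iff.2 hU,
      h.isDynamicModelWrt hU⟩
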